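/- Let $SG_3$ be the attractor of the six homotheties $F_0,\dots,F_5$ of ratio $1/3$ of an equilateral triangle with corners $q_0,q_1,q_2$, where $F_0,F_1,F_2$ fix the corners and $F_3,F_4,F_5$ fix the midpoints of the sides. Let $\mu$ be its self-similar probability measure with all weights $1/6$. Let $G_0$ be the complete graph on $V_0=\{q_0,q_1,q_2\}$, let $G_{m+1}=\bigcup_j F_j(G_m)$ with vertex set $V_{m+1}$, and write $x\sim_m y$ for adjacency in $G_m$. With $r=7/15$ let $$\mathcal E(u,v)=\lim_{m\to\infty} r^{-m}\,\tfrac12\sum_{x\sim_m y}(u(x)-u(y))(v(x)-v(y)),$$ whose domain consists of the continuous functions $u$ on $SG_3$ for which $r^{-m}\,\tfrac12\sum_{x\sim_m y}|u(x)-u(y)|^2$ stays bounded in $m$. For $u$ in this domain and $f$ continuous, $\Delta u=f$ means that $\mathcal E(u,v)=-\int f v\,d\mu$ for all $v$ in the domain that vanish on $V_0$. The normal derivative of $u$ at $q_i$ is $$\partial_n u(q_i)=\lim_{m\to\infty} r^{-m}\sum_{y\sim_m q_i}(u(q_i)-u(y)).$$ Let $(\lambda_m)_{m\ge0}$ be a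 sequence of real (or complex) numbers with $\lambda_0\neq0$, $$\lambda_{m}\,(14-3\lambda_{m+1})=3\lambda_{m+1}(3-\lambda_{m+1})(4-\lambda_{m+1})(5-\lambda_{m+1})\qquad(m\ge 0),$$ such that $\lambda_j\notin\{3,5,3\pm\sqrt5\}$ for $j\ge1$ and the limit $$\lambda=\tfrac32\lim_{m\to\infty}\left(\tfrac{90}{7}\right)^m\lambda_m$$ exists. Let $u$ be a real-valued (or complex-valued) function on $SG_3$ with $-\Delta u=\lambda u$ and $u(q_0)=1$, $u(q_1)=u(q_2)=0$. Then the infinite product in $$\tau(\lambda)=\frac{2\lambda}{3\lambda_0}\prod_{j=1}^{\infty}\frac{(1-\frac{\lambda_j}{4})(1-\frac{\lambda_j}{6})}{1-\frac32\lambda_j+\frac{\lambda_j^2}{4}}$$ converges unconditionally, the normal derivatives of $u$ at the three boundary points exist, and $$\partial_n u(q_0)=\frac{4-\lambda_0}{2}\,\tau(\lambda),\qquad \partial_n u(q_1)=\partial_n u(q_2)=-\tau(\lambda).$$ -/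

import Mathlib

open Filter Topology MeasureTheory

noncomputable section

namespace SGThree

/-- The ambient Euclidean space. The triangle carrying the fractal is the equilateral triangle
whose corners are the three standard basis vectors (barycentric coordinates). -/
abbrev Ambient : Type := EuclideanSpace ℝ (Fin 3)

/-- The corners of the triangle. -/
def corner (i : Fin 3) : Ambient := EuclideanSpace.single i 1

/-- Translation parts of the six maps. -/
def shift : Fin 6 → Ambient :=
  ![corner 0 + corner 0, corner 1 + corner 1, corner 2 + corner 2,
    corner 1 + corner 2, corner 0 + corner 2, corner 0 + corner 1]

/-- The iterated function system: six homotheties of ratio `1/3`, fixing the three corners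
(`j = 0, 1, 2`) and the three midpoints of the sides (`j = 3, 4, 5`). -/
def contraction (j : Fin 6) (x : Ambient) : Ambient := (1 / 3 : ℝ) • (x + shift j)

/-- The point with address `ω`, i.e. the limit of `F_{ω 0} ∘ ⋯ ∘ F_{ω n}` at any point. -/
def coding (ω : ℕ → Fin 6) : Ambient := ∑' k, (1 / 3 : ℝ) ^ (k + 1) • shift (ω k)

/-- The attractor of the iterated function system; see `carrier_isCompact`, `carrier_nonempty`,
`carrier_eq_iUnion` and `eq_carrier` for the characterization as the unique nonempty compact
fixed point. -/
def carrier : Set Ambient := Set.range coding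

/-- Prepending a letter to an address. -/
def consWord (j : Fin 6) (ω : ℕ → Fin 6) : ℕ → Fin 6
  | 0 => j
  | k + 1 => ω k

theorem norm_shift_le (j : Fin 6) : ‖shift j‖ ≤ 2 := by
  have h : ∀ a b : Fin 3, ‖corner a + corner b‖ ≤ 2 := fun a b =>
    (norm_add_le _ _).trans (by simp [corner]; norm_num)
  fin_cases j <;> simp only [shift] <;> exact h _ _

theorem norm_term_le (k : ℕ) (j : Fin 6) :
    ‖(1 / 3 : ℝ) ^ (k + 1) • shift j‖ ≤ (1 / 3 : ℝ) ^ k := by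
  rw [norm_smul, Real.norm_of_nonneg (by positivity), pow_succ]
  nlinarith [norm_shift_le j, pow_pos (show (0 : ℝ) < 1 / 3 by norm_num) k]

theorem summable_geom : Summable fun k : ℕ => (1 / 3 : ℝ) ^ k :=
  summable_geometric_of_lt_one (by norm_num) (by norm_num)

theorem summable_coding (ω : ℕ → Fin 6) :
    Summable fun k => (1 / 3 : ℝ) ^ (k + 1) • shift (ω k) :=
  Summable.of_norm_bounded summable_geom fun k => norm_term_le k (ω k)

theorem continuous_coding : Continuous coding := by
  refine continuous_tsum (fun k => ?_) summable_geom fun k ω => norm_term_le k (ω k)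
  have h : Continuous fun ω : ℕ → Fin 6 => shift (ω k) :=
    (continuous_of_discreteTopology (f := shift)).comp (continuous_apply (A := fun _ => Fin 6) k)
  exact h.const_smul ((1 / 3 : ℝ) ^ (k + 1))

theorem coding_consWord (j : Fin 6) (ω : ℕ → Fin 6) :
    coding (consWord j ω) = contraction j (coding ω) := by
  unfold coding contraction
  rw [(summable_coding (consWord j ω)).tsum_eq_zero_add, smul_add, ← tsum_const_smul'']
  rw [add_comm]
  congr 1
  · refine tsum_congr fun k => ?_
    simp only [consWord]
    rw [smul_smul, ← pow_succ']
  · simp [consWord]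

theorem consWord_head_tail (ω : ℕ → Fin 6) : consWord (ω 0) (fun k => ω (k + 1)) = ω := by
  funext k
  cases k <;> rfl

theorem carrier_isCompact : IsCompact carrier := isCompact_range continuous_coding

theorem carrier_nonempty : carrier.Nonempty := Set.range_nonempty _

theorem contraction_mem (j : Fin 6) {x : Ambient} (hx : x ∈ carrier) :
    contraction j x ∈ carrier := by
  obtain ⟨ω, rfl⟩ := hx
  exact ⟨consWord j ω, coding_consWord j ω⟩

theorem carrier_eq_iUnion : carrier = ⋃ j, contraction j '' carrier := by
  apply Set.Subset.antisymm
  · rintro _ ⟨ω, rfl⟩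
    refine Set.mem_iUnion.2 ⟨ω 0, coding fun k => ω (k + 1), ⟨_, rfl⟩, ?_⟩
    rw [← coding_consWord, consWord_head_tail]
  · refine Set.iUnion_subset fun j => ?_
    rintro _ ⟨x, hx, rfl⟩
    exact contraction_mem j hx

theorem dist_contraction (j : Fin 6) (x y : Ambient) :
    dist (contraction j x) (contraction j y) = 1 / 3 * dist x y := by
  unfold contraction
  rw [dist_smul₀, dist_add_right, Real.norm_of_nonneg (by norm_num)]

theorem subset_of_isCompact {A B : Set Ambient} (hA : IsCompact A) (hB : IsCompact B)
    (hB0 : B.Nonempty) (h1 : A ⊆ ⋃ j, contraction j '' A) (h2 : ⋃ j, contraction j '' B ⊆ B) :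
    A ⊆ B := by
  obtain ⟨b, hb⟩ := hB0
  obtain ⟨M, hM⟩ := hA.isBounded.subset_closedBall b
  have key : ∀ n : ℕ, ∀ x ∈ A, ∃ y ∈ B, dist x y ≤ (1 / 3 : ℝ) ^ n * M := by
    intro n
    induction n with
    | zero => exact fun x hx => ⟨b, hb, by simpa using hM hx⟩
    | succ n ih =>
      intro x hx
      obtain ⟨j, x', hx', rfl⟩ := Set.mem_iUnion.1 (h1 hx)
      obtain ⟨y, hy, hxy⟩ := ih x' hx'
      refine ⟨contraction j y, h2 (Set.mem_iUnion.2 ⟨j, y, hy, rfl⟩), ?_⟩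
      rw [dist_contraction, pow_succ]
      linarith
  intro x hx
  refine hB.isClosed.closure_subset (Metric.mem_closure_iff.2 fun ε hε => ?_)
  have hlim : Tendsto (fun n : ℕ => (1 / 3 : ℝ) ^ n * M) atTop (𝓝 0) := by
    simpa using (tendsto_pow_atTop_nhds_zero_of_lt_one
      (by norm_num : (0 : ℝ) ≤ 1 / 3) (by norm_num)).mul_const M
  obtain ⟨n, hn⟩ := (hlim.eventually (gt_mem_nhds hε)).exists
  obtain ⟨y, hy, hxy⟩ := key n x hx
  exact ⟨y, hy, hxy.trans_lt hn⟩

theorem eq_carrier {A : Set Ambient} (hA : IsCompact A) (hA0 : A.Nonempty)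
    (h : A = ⋃ j, contraction j '' A) : A = carrier :=
  Set.Subset.antisymm
    (subset_of_isCompact hA carrier_isCompact carrier_nonempty h.subset carrier_eq_iUnion.superset)
    (subset_of_isCompact carrier_isCompact hA hA0 carrier_eq_iUnion.subset h.superset)

theorem corner_mem (i : Fin 3) : corner i ∈ carrier := by
  refine ⟨fun _ => Fin.castLE (by norm_num) i, ?_⟩
  have hs : shift (Fin.castLE (by norm_num) i) = (2 : ℝ) • corner i := by
    fin_cases i <;> simp [shift, two_smul]
  unfold coding
  simp only [hs, smul_smul]
  rw [Summable.tsum_smul_const]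
  · have : (∑' k : ℕ, (1 / 3 : ℝ) ^ (k + 1) * 2) = 1 := by
      simp only [pow_succ, mul_assoc]
      rw [tsum_mul_right, tsum_geometric_of_lt_one (by norm_num) (by norm_num)]
      norm_num
    rw [this, one_smul]
  · simp only [pow_succ, mul_assoc]
    exact summable_geom.mul_right _

end SGThree

/-- The fractal `SG₃`. -/
abbrev SG3 : Type := SGThree.carrier

namespace SGThree

/-- The maps `F_j` of the iterated function system, acting on `SG₃`. -/
def F (j : Fin 6) (x : SG3) : SG3 := ⟨contraction j x, contraction_mem j x.2⟩

/-- The boundary points `q₀, q₁, q₂` of `SG₃`. -/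
def q (i : Fin 3) : SG3 := ⟨corner i, corner_mem i⟩

open Classical in
/-- The vertex sets: `V₀` consists of the boundary points and `V_{m+1} = ⋃ j, F_j (V_m)`. -/
def V : ℕ → Finset SG3
  | 0 => Finset.univ.image q
  | m + 1 => Finset.univ.biUnion fun j => (V m).image (F j)

/-- The adjacency relations `x ∼_m y`: `G₀` is the complete graph on `V₀`, and `G_{m+1}` is the
union of the images of `G_m` under the maps `F_j`. -/
def Adj : ℕ → SG3 → SG3 → Prop
  | 0 => fun x y => x ∈ V 0 ∧ y ∈ V 0 ∧ x ≠ y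
  | m + 1 => fun x y => ∃ j x' y', Adj m x' y' ∧ F j x' = x ∧ F j y' = y

/-- The map from addresses to points of `SG₃`. -/
def address (ω : ℕ → Fin 6) : SG3 := ⟨coding ω, ω, rfl⟩

/-- The uniform product measure on addresses. -/
def addressMeasure : Measure (ℕ → Fin 6) :=
  Measure.infinitePi fun _ : ℕ => (PMF.uniformOfFintype (Fin 6)).toMeasure

instance : IsProbabilityMeasure addressMeasure := by
  unfold addressMeasure; infer_instance

/-- The standard self-similar probability measure on `SG₃`, all weights being `1/6`;
see `mu_selfSimilar`. -/
def mu : Measure SG3 := addressMeasure.map address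

theorem measurable_address : Measurable address :=
  (continuous_coding.subtype_mk _).measurable

instance : IsProbabilityMeasure mu :=
  Measure.isProbabilityMeasure_map measurable_address.aemeasurable

theorem measurable_consWord (j : Fin 6) : Measurable (consWord j) := by
  refine measurable_pi_lambda _ fun k => ?_
  cases k with
  | zero => exact measurable_const
  | succ k => exact measurable_pi_apply k

theorem measurable_F (j : Fin 6) : Measurable (F j) := by
  refine Measurable.subtype_mk (Continuous.measurable ?_)
  unfold contraction
  fun_prop

theorem addressMeasure_selfSimilar :
    addressMeasure = ∑ j : Fin 6, (1 / 6 : ENNReal) • addressMeasure.map (consWord j) := by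
  classical
  symm
  refine Measure.eq_infinitePi _ fun s t ht => ?_
  set U : Measure (Fin 6) := (PMF.uniformOfFintype (Fin 6)).toMeasure with hU
  obtain ⟨N, hN⟩ : ∃ N, s ⊆ Finset.range (N + 1) :=
    ⟨s.sup id, fun k hk => Finset.mem_range.2 (Nat.lt_succ_of_le (Finset.le_sup (f := id) hk))⟩
  set t' : ℕ → Set (Fin 6) := fun k => if k ∈ s then t k else Set.univ with ht'
  have hset : Set.pi (s : Set ℕ) t = Set.pi (Finset.range (N + 1) : Set ℕ) t' := by
    ext ω
    simp only [Set.mem_pi, Finset.mem_coe, ht']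
    constructor
    · intro h k _
      by_cases hk : k ∈ s
      · simpa [hk] using h k hk
      · simp [hk]
    · intro h k hk
      simpa [hk] using h k (hN hk)
  have hprod : ∏ k ∈ s, U (t k) = ∏ k ∈ Finset.range (N + 1), U (t' k) := by
    rw [← Finset.prod_subset hN]
    · exact Finset.prod_congr rfl fun k hk => by simp [ht', hk]
    · intro k _ hk
      simp [ht', hk]
  have hms : MeasurableSet (Set.pi (Finset.range (N + 1) : Set ℕ) t') :=
    MeasurableSet.pi (Finset.countable_toSet _) fun _ _ => MeasurableSet.of_discrete
  have hpre : ∀ j, addressMeasure (consWord j ⁻¹' Set.pi (Finset.range (N + 1) : Set ℕ) t') =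
      (t' 0).indicator 1 j * ∏ k ∈ Finset.range N, U (t' (k + 1)) := by
    intro j
    by_cases hj : j ∈ t' 0
    · have : consWord j ⁻¹' Set.pi (Finset.range (N + 1) : Set ℕ) t' =
          Set.pi (Finset.range N : Set ℕ) fun k => t' (k + 1) := by
        ext ω
        simp only [Set.mem_preimage, Set.mem_pi, Finset.coe_range, Set.mem_Iio]
        constructor
        · intro h k hk
          exact h (k + 1) (by omega)
        · intro h k hk
          cases k with
          | zero => exact hj
          | succ k => exact h k (by omega)
      rw [this, addressMeasure, Measure.infinitePi_pi _ fun _ _ => MeasurableSet.of_discrete]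
      simp [hj, hU]
    · have : consWord j ⁻¹' Set.pi (Finset.range (N + 1) : Set ℕ) t' = ∅ := by
        ext ω
        simp only [Set.mem_preimage, Set.mem_pi, Set.mem_empty_iff_false, iff_false]
        exact fun h => hj (h 0 (by simp))
      rw [this]
      simp [hj]
  have hU0 : U (t' 0) = ∑ j : Fin 6, 1 / 6 * (t' 0).indicator 1 j := by
    rw [hU, PMF.toMeasure_apply_fintype]
    refine Finset.sum_congr rfl fun j _ => ?_
    by_cases hj : j ∈ t' 0 <;> simp [hj]
  rw [hset, hprod, Finset.prod_range_succ', hU0, mul_comm, Finset.sum_mul]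
  simp only [Measure.coe_finsetSum, Finset.sum_apply, Measure.smul_apply, smul_eq_mul]
  refine Finset.sum_congr rfl fun j _ => ?_
  rw [Measure.map_apply (measurable_consWord j) hms, hpre, mul_assoc]

theorem mu_selfSimilar : mu = ∑ j : Fin 6, (1 / 6 : ENNReal) • mu.map (F j) := by
  have h : ∀ j, mu.map (F j) = (addressMeasure.map (consWord j)).map address := by
    intro j
    rw [mu, Measure.map_map (measurable_F j) measurable_address,
      Measure.map_map measurable_address (measurable_consWord j)]
    congr 1
    funext ω
    exact Subtype.ext (coding_consWord j ω).symm
  simp only [h]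
  conv_lhs => rw [mu, addressMeasure_selfSimilar]
  ext s hs
  rw [Measure.map_apply measurable_address hs]
  simp only [Measure.coe_finsetSum, Finset.sum_apply, Measure.smul_apply]
  refine Finset.sum_congr rfl fun j _ => ?_
  rw [Measure.map_apply measurable_address hs]

/-- The energy renormalization factor of `SG₃`. -/
def r : ℝ := 7 / 15

section Functions

variable {𝕜 : Type*} [RCLike 𝕜]

open Classical in
/-- The renormalized graph energies
`r⁻ᵐ · (1/2) · ∑_{x ∼_m y} (u x - u y) (v x - v y)`, as a bilinear form. -/
def graphEnergy (m : ℕ) (u v : SG3 → 𝕜) : 𝕜 :=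
  ((r⁻¹ ^ m * (1 / 2) : ℝ) : 𝕜) *
    ∑ x ∈ V m, ∑ y ∈ V m with Adj m x y, (u x - u y) * (v x - v y)

open Classical in
/-- The domain of the energy: continuous functions whose renormalized graph energies
`r⁻ᵐ · (1/2) · ∑_{x ∼_m y} |u x - u y|²` (which are nondecreasing in `m`) stay bounded. -/
def InDomEnergy (u : SG3 → 𝕜) : Prop :=
  Continuous u ∧ BddAbove (Set.range fun m : ℕ =>
    r⁻¹ ^ m * (1 / 2) * ∑ x ∈ V m, ∑ y ∈ V m with Adj m x y, ‖u x - u y‖ ^ 2)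

/-- `u ∈ dom Δ` with `Δ u = f`: the function `u` has finite energy, `f` is continuous, and
`ℰ(u, v) = - ∫ f v dμ` for all `v` of finite energy vanishing on the boundary, where `ℰ(u, v)` is
the limit of the renormalized graph energies. -/
def HasLaplacian (u f : SG3 → 𝕜) : Prop :=
  InDomEnergy u ∧ Continuous f ∧
    ∀ v : SG3 → 𝕜, InDomEnergy v → (∀ i, v (q i) = 0) →
      Tendsto (fun m => graphEnergy m u v) atTop (𝓝 (-∫ x, f x * v x ∂mu))

open Classical in
/-- The normal derivative of `u` at the boundary point `q i` exists and equals `d`: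
`lim_m r⁻ᵐ ∑_{y ∼_m q i} (u (q i) - u y) = d`. -/
def HasNormalDeriv (u : SG3 → 𝕜) (i : Fin 3) (d : 𝕜) : Prop :=
  Tendsto (fun m : ℕ => ((r⁻¹ ^ m : ℝ) : 𝕜) *
    ∑ y ∈ V m with Adj m (q i) y, (u (q i) - u y)) atTop (𝓝 d)

/-- `l` is a spectral decimation sequence for `lam`: consecutive terms are linked by the
decimation relation `l m = 3 l' (3 - l') (4 - l') (5 - l') / (14 - 3 l')` with `l' = l (m + 1)`,
no term of positive index is one of the forbidden values `3`, `5`, `3 ± √5`, and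
`lam = (3/2) lim (90/7)ᵐ l m`. -/
structure IsDecimationSequence (l : ℕ → 𝕜) (lam : 𝕜) : Prop where
  relation : ∀ m, l m * (14 - 3 * l (m + 1)) =
    3 * l (m + 1) * (3 - l (m + 1)) * (4 - l (m + 1)) * (5 - l (m + 1))
  not_forbidden : ∀ m, (5 - l (m + 1)) * (3 - l (m + 1)) *
    (4 - 6 * l (m + 1) + l (m + 1) ^ 2) ≠ 0
  tendsto : Tendsto (fun m : ℕ => (3 / 2 : 𝕜) * ((90 / 7 : 𝕜) ^ m * l m)) atTop (𝓝 lam)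

/-- The factors of the infinite product, as a function of the term of the sequence. -/
def tauFactor (x : 𝕜) : 𝕜 :=
  (1 - x / 4) * (1 - x / 6) / (1 - 3 / 2 * x + x ^ 2 / 4)

/-- `τ(lam) = (2 lam / (3 l₀)) ∏_{j ≥ 1} tauFactor (l j)`. -/
def tau (l : ℕ → 𝕜) (lam : 𝕜) : 𝕜 :=
  2 * lam / (3 * l 0) * ∏' j : ℕ, tauFactor (l (j + 1))

end Functions

end SGThree

end

/-! The eigenfunction `u` is never constructed; its equation is only tested against explicit
splines. Fix a corner `q i`. Let `T m` be the function with corner values `Pi.single i 1`, extended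
to the vertices of level `m` by spectral decimation with parameters `l 1, …, l m` and harmonically
inside each cell of level `m` (`decimated`). Let `S m` be the spline of level `m` that is 1 at `q i`
and 0 at the other vertices (`spike`). The difference `T m - S m` vanishes on the boundary, and the
renormalized energies of `u` against a spline of level `m` are constant from level `m` on. Hence the
weak equation becomes an exact identity at level `m` (`HasLaplacian.graphEnergy_spline`).

In this identity `S m` contributes the discrete flux of `u` at `q i` (`rawEnergy_spike`), whose
renormalized limit is the normal derivative. By a discrete Green formula (`rawEnergy_decimated`), `T
m` contributes a boundary term times the product of the `fluxFactor (l k)`, plus `l m / 2` times a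
sum of `u * T m` over cell corners. Three limits finish the argument:

The vertex sum is a quadrature for the integral of `u * T m`, because the three-corner mean
integrates harmonic functions exactly, `u` is uniformly continuous and the `T m` are uniformly
bounded. Since `(3/2) (90/7)^m l m` tends to `lam`, this term cancels `lam * ∫ u * T m` in the
limit; convergence of `T m` is not needed.

The integral of `u * S m` tends to 0, since `S m` lives on a cell of measure `6^(-m)`.

The decimation relation gives `fluxFactor (l (k+1)) * l k = 6 * l (k+1) * tauFactor (l (k+1))`. The
product therefore telescopes, and after multiplication by `r⁻¹ ^ m` it tends to `tau l lam`.

The boundary term left over is `∑ a, u (q a) * cornerDeriv (l 0) (Pi.single i 1) a`, which equals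
`(4 - l 0) / 2` for `i = 0` and `-1` otherwise. -/

noncomputable section
namespace SGThree

/-! ### Geometry of the cells -/

/-- Integer coordinates of the translation parts. -/
def shiftCoord (j : Fin 6) : Fin 3 → ℕ :=
  ![![2, 0, 0], ![0, 2, 0], ![0, 0, 2], ![0, 1, 1], ![1, 0, 1], ![1, 1, 0]] j

theorem shift_apply (j : Fin 6) (k : Fin 3) : shift j k = shiftCoord j k := by
  fin_cases j <;> fin_cases k <;> simp [shift, shiftCoord, corner] <;> norm_num

theorem contraction_apply (j : Fin 6) (x : Ambient) (k : Fin 3) :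
    contraction j x k = (x k + shiftCoord j k) / 3 := by
  simp only [contraction, PiLp.smul_apply, PiLp.add_apply, shift_apply, smul_eq_mul]
  ring

theorem sum_shiftCoord (j : Fin 6) : ∑ k, shiftCoord j k = 2 := by
  revert j; decide

theorem coe_F_apply (j : Fin 6) (x : SG3) (k : Fin 3) :
    (F j x : Ambient) k = ((x : Ambient) k + shiftCoord j k) / 3 :=
  contraction_apply j x k

theorem carrier_subset_simplex : carrier ⊆ (WithLp.toLp 2) '' stdSimplex ℝ (Fin 3) := by
  refine subset_of_isCompact carrier_isCompact
    ((isCompact_stdSimplex ℝ (Fin 3)).image (PiLp.continuous_toLp 2 _)) ?_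
    carrier_eq_iUnion.subset ?_
  · exact ⟨_, Set.mem_image_of_mem _ (single_mem_stdSimplex ℝ 0)⟩
  · refine Set.iUnion_subset fun j => ?_
    rintro _ ⟨_, ⟨x, ⟨h0, h1⟩, rfl⟩, rfl⟩
    refine ⟨WithLp.ofLp (contraction j (WithLp.toLp 2 x)), ⟨fun k => ?_, ?_⟩, rfl⟩
    · rw [contraction_apply]
      have := h0 k
      positivity
    · simp only [contraction_apply]
      rw [← Finset.sum_div, Finset.sum_add_distrib, h1]
      have := sum_shiftCoord j
      rw [← Nat.cast_sum, this]
      norm_num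

theorem coord_nonneg (x : SG3) (k : Fin 3) : 0 ≤ (x : Ambient) k := by
  obtain ⟨y, hy, h⟩ := carrier_subset_simplex x.2
  rw [← h]
  exact hy.1 k

theorem sum_coord (x : SG3) : ∑ k, (x : Ambient) k = 1 := by
  obtain ⟨y, hy, h⟩ := carrier_subset_simplex x.2
  rw [← h]
  exact hy.2

theorem coord_le_one (x : SG3) (k : Fin 3) : (x : Ambient) k ≤ 1 := by
  rw [← sum_coord x]
  exact Finset.single_le_sum (fun i _ => coord_nonneg x i) (Finset.mem_univ k)

theorem coe_q_apply (a k : Fin 3) : (q a : Ambient) k = if k = a then 1 else 0 := by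
  simp [q, corner]

theorem SG3_ext {x y : SG3} (h : ∀ k, (x : Ambient) k = (y : Ambient) k) : x = y :=
  Subtype.ext (PiLp.ext h)

theorem eq_q_of_one_le {x : SG3} {a : Fin 3} (h : 1 ≤ (x : Ambient) a) : x = q a := by
  refine SG3_ext fun k => ?_
  rw [coe_q_apply]
  have ha : (x : Ambient) a = 1 := le_antisymm (coord_le_one x a) h
  split_ifs with hk
  · rw [hk, ha]
  · have h1 := sum_coord x
    rw [← Finset.add_sum_erase _ _ (Finset.mem_univ a), ha] at h1
    have h2 : ∑ k ∈ Finset.univ.erase a, (x : Ambient) k = 0 := by linarith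
    exact (Finset.sum_eq_zero_iff_of_nonneg fun i _ => coord_nonneg x i).1 h2 k
      (Finset.mem_erase.2 ⟨hk, Finset.mem_univ k⟩)

theorem q_injective : Function.Injective q := by
  intro a b h
  by_contra hab
  have := coe_q_apply b a
  rw [← h, coe_q_apply] at this
  simp [hab] at this

theorem F_injective (j : Fin 6) : Function.Injective (F j) := by
  intro x y h
  refine SG3_ext fun k => ?_
  have := coe_F_apply j x k
  rw [h, coe_F_apply] at this
  linarith

theorem continuous_F (j : Fin 6) : Continuous (F j) := by
  refine Continuous.subtype_mk ?_ _
  unfold contraction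
  fun_prop

/-- Distinct cells meet in at most one point, which is a corner of both cells. -/
theorem exists_corner_of_ne {i j : Fin 6} (hij : i ≠ j) :
    ∃ a c, ∀ x y, F i x = F j y → x = q a ∧ y = q c := by
  -- Translation vectors all have coordinate sum 2, so distinct ones differ by at least 1 in each
  -- direction. As coordinates lie in `[0, 1]`, a common point must have coordinate 1 in its cell,
  -- hence be a corner.
  have key : ∀ i j : Fin 6, i ≠ j → ∃ a, shiftCoord i a + 1 ≤ shiftCoord j a := by decide
  obtain ⟨a, ha⟩ := key i j hij
  obtain ⟨c, hc⟩ := key j i hij.symm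
  have ha' : (shiftCoord i a : ℝ) + 1 ≤ shiftCoord j a := by exact_mod_cast ha
  have hc' : (shiftCoord j c : ℝ) + 1 ≤ shiftCoord i c := by exact_mod_cast hc
  refine ⟨a, c, fun x y h => ?_⟩
  have hk : ∀ k, (x : Ambient) k + shiftCoord i k = (y : Ambient) k + shiftCoord j k := by
    intro k
    have := coe_F_apply i x k
    rw [h, coe_F_apply] at this
    linarith
  constructor
  · apply eq_q_of_one_le
    have := hk a
    have := coord_nonneg y a
    linarith
  · apply eq_q_of_one_le
    have := hk c
    have := coord_nonneg x c
    linarith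

/-- The index of the map fixing a corner. -/
def fixIndex (a : Fin 3) : Fin 6 := Fin.castLE (by norm_num) a

theorem fixIndex_injective : Function.Injective fixIndex := by
  unfold Function.Injective; decide

theorem F_fixIndex (a : Fin 3) : F (fixIndex a) (q a) = q a := by
  refine SG3_ext fun k => ?_
  rw [coe_F_apply, coe_q_apply]
  have : ∀ a k : Fin 3, shiftCoord (fixIndex a) k = if k = a then 2 else 0 := by decide
  rw [this]
  split_ifs <;> norm_num

theorem F_eq_q {j : Fin 6} {x : SG3} {a : Fin 3} (h : F j x = q a) :
    j = fixIndex a ∧ x = q a := by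
  have h1 := coe_F_apply j x a
  rw [h, coe_q_apply, if_pos rfl] at h1
  have hx := coord_le_one x a
  have h2 : (2 : ℝ) ≤ shiftCoord j a := by linarith
  have h3 : 2 ≤ shiftCoord j a := by exact_mod_cast h2
  have key : ∀ (j : Fin 6) (a : Fin 3), 2 ≤ shiftCoord j a → j = fixIndex a := by decide
  have hj := key j a h3
  refine ⟨hj, ?_⟩
  rw [hj, ← F_fixIndex a] at h
  exact F_injective _ h

/-- Index of the vertex `F j (q a)` among the ten vertices of the first graph: the corners are
`0, 1, 2`, and `9` is the center. -/
def node (j : Fin 6) (a : Fin 3) : Fin 10 :=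
  ![![0, 3, 4], ![5, 1, 6], ![7, 8, 2], ![9, 6, 8], ![4, 9, 7], ![3, 5, 9]] j a

/-- Multiplied by 3, both points have natural number coordinates, so the incidence table `node` is
checked by a finite computation. -/
theorem F_q_eq_iff (i j : Fin 6) (a c : Fin 3) : F i (q a) = F j (q c) ↔ node i a = node j c := by
  have key : ∀ (i j : Fin 6) (a c : Fin 3), node i a = node j c ↔
      ∀ k, (if k = a then 1 else 0) + shiftCoord i k =
        (if k = c then 1 else 0) + shiftCoord j k := by
    decide
  rw [key]
  have hF : ∀ (i : Fin 6) (a k : Fin 3), (F i (q a) : Ambient) k =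
      (((if k = a then 1 else 0) + shiftCoord i k : ℕ) : ℝ) / 3 := by
    intro i a k
    rw [coe_F_apply, coe_q_apply]
    push_cast
    rfl
  constructor
  · intro h k
    have := hF i a k
    rw [h, hF] at this
    have h3 := (div_left_inj' (by norm_num : (3 : ℝ) ≠ 0)).1 this
    exact_mod_cast h3.symm
  · intro h
    refine SG3_ext fun k => ?_
    rw [hF, hF, h k]

theorem exists_F_eq (x : SG3) : ∃ j y, F j y = x := by
  obtain ⟨j, y, hy, h⟩ := Set.mem_iUnion.1 (carrier_eq_iUnion.subset x.2)
  exact ⟨j, ⟨y, hy⟩, Subtype.ext h⟩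

instance : CompactSpace SG3 := isCompact_iff_compactSpace.1 carrier_isCompact

theorem dist_F (j : Fin 6) (x y : SG3) : dist (F j x) (F j y) = 1 / 3 * dist x y :=
  dist_contraction j x y

theorem integral_eq_sum_cells {𝕜 : Type*} [RCLike 𝕜] {f : SG3 → 𝕜} (hf : Continuous f) :
    ∫ x, f x ∂mu = (1 / 6 : 𝕜) * ∑ j, ∫ x, f (F j x) ∂mu := by
  have hmap : ∀ j, Integrable f (mu.map (F j)) := fun j =>
    haveI := Measure.isProbabilityMeasure_map (μ := mu) (measurable_F j).aemeasurable
    hf.integrable_of_hasCompactSupport (HasCompactSupport.of_compactSpace f)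
  conv_lhs => rw [mu_selfSimilar]
  rw [integral_finsetSum_measure fun j _ => (hmap j).smul_measure (by simp), Finset.mul_sum]
  refine Finset.sum_congr rfl fun j _ => ?_
  rw [integral_smul_measure, integral_map (measurable_F j).aemeasurable
    (hf.aestronglyMeasurable)]
  rw [RCLike.real_smul_eq_coe_mul]
  congr 1
  simp [RCLike.ofReal_ofNat]

/-! ### Edge sums -/

theorem Adj.mem {m : ℕ} : ∀ {x y : SG3}, Adj m x y → x ∈ V m ∧ y ∈ V m ∧ x ≠ y := by
  classical
  induction m with
  | zero => exact fun h => h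
  | succ m ih =>
    rintro _ _ ⟨j, x, y, h, rfl, rfl⟩
    obtain ⟨hx, hy, hxy⟩ := ih h
    refine ⟨?_, ?_, fun h => hxy (F_injective j h)⟩
    · simp only [V, Finset.mem_biUnion, Finset.mem_image]
      exact ⟨j, Finset.mem_univ _, x, hx, rfl⟩
    · simp only [V, Finset.mem_biUnion, Finset.mem_image]
      exact ⟨j, Finset.mem_univ _, y, hy, rfl⟩

open Classical in
/-- The set of ordered edges of the `m`-th graph. -/
def edges (m : ℕ) : Finset (SG3 × SG3) := (V m ×ˢ V m).filter fun p => Adj m p.1 p.2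

theorem mem_edges {m : ℕ} {p : SG3 × SG3} : p ∈ edges m ↔ Adj m p.1 p.2 := by
  simp only [edges, Finset.mem_filter, Finset.mem_product, and_iff_right_iff_imp]
  exact fun h => ⟨h.mem.1, h.mem.2.1⟩

open Classical in
theorem edges_succ (m : ℕ) : edges (m + 1) =
    Finset.univ.biUnion fun j => (edges m).image (Prod.map (F j) (F j)) := by
  ext ⟨x, y⟩
  simp only [mem_edges, Finset.mem_biUnion, Finset.mem_image, Finset.mem_univ, true_and,
    Prod.exists, Prod.map, Prod.mk.injEq, Adj]

variable {M : Type*} [AddCommMonoid M]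

open Classical in
theorem sum_adj_eq_sum_edges (m : ℕ) (f : SG3 → SG3 → M) :
    ∑ x ∈ V m, ∑ y ∈ V m with Adj m x y, f x y = ∑ p ∈ edges m, f p.1 p.2 := by
  rw [edges, Finset.sum_filter, Finset.sum_product]
  exact Finset.sum_congr rfl fun x _ => Finset.sum_filter _ _

/-- No edge is counted twice: distinct cells share at most one point, while an edge has two distinct
endpoints. -/
theorem sum_edges_succ (m : ℕ) (f : SG3 → SG3 → M) :
    ∑ p ∈ edges (m + 1), f p.1 p.2 = ∑ j, ∑ p ∈ edges m, f (F j p.1) (F j p.2) := by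
  classical
  rw [edges_succ, Finset.sum_biUnion]
  · refine Finset.sum_congr rfl fun j _ => ?_
    rw [Finset.sum_image fun p _ p' _ h => (F_injective j).prodMap (F_injective j) h]
    rfl
  · intro i _ j _ hij
    refine Finset.disjoint_left.2 ?_
    rintro _ hi hj
    obtain ⟨⟨x, y⟩, hp, rfl⟩ := Finset.mem_image.1 hi
    obtain ⟨⟨x', y'⟩, hp', h⟩ := Finset.mem_image.1 hj
    obtain ⟨a, c, hac⟩ := exists_corner_of_ne hij
    simp only [Prod.map, Prod.mk.injEq] at h
    have hx := (hac x x' h.1.symm).1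
    have hy := (hac y y' h.2.symm).1
    exact (mem_edges.1 hp).mem.2.2 (hx.trans hy.symm)

theorem sum_edges_zero (f : SG3 → SG3 → M) :
    ∑ p ∈ edges 0, f p.1 p.2 =
      f (q 0) (q 1) + f (q 0) (q 2) + (f (q 1) (q 0) + f (q 1) (q 2)) +
        (f (q 2) (q 0) + f (q 2) (q 1)) := by
  classical
  rw [← sum_adj_eq_sum_edges]
  simp only [Finset.sum_filter]
  simp only [V, Adj, Finset.sum_image fun a _ b _ h => q_injective h]
  simp [Fin.sum_univ_three, q_injective.eq_iff]

open Classical in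
/-- The sum defining the normal derivative, without the normalization. -/
def flux {𝕜 : Type*} [RCLike 𝕜] (m : ℕ) (u : SG3 → 𝕜) (i : Fin 3) : 𝕜 :=
  ∑ y ∈ V m with Adj m (q i) y, (u (q i) - u y)

open Classical in
-- The only cell containing `q i` is that of `fixIndex i`, so all neighbours of `q i` lie in it.
theorem flux_succ {𝕜 : Type*} [RCLike 𝕜] (m : ℕ) (u : SG3 → 𝕜) (i : Fin 3) :
    flux (m + 1) u i = flux m (u ∘ F (fixIndex i)) i := by
  unfold flux
  have h : (V (m + 1)).filter (Adj (m + 1) (q i)) =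
      ((V m).filter (Adj m (q i))).image (F (fixIndex i)) := by
    ext y
    simp only [Finset.mem_filter, Finset.mem_image]
    constructor
    · rintro ⟨-, j, x, y, h, hx, rfl⟩
      obtain ⟨rfl, rfl⟩ := F_eq_q hx
      exact ⟨y, ⟨h.mem.2.1, h⟩, rfl⟩
    · rintro ⟨y, ⟨-, h⟩, rfl⟩
      have h' : Adj (m + 1) (q i) (F (fixIndex i) y) := ⟨_, _, _, h, F_fixIndex i, rfl⟩
      exact ⟨h'.mem.2.1, h'⟩
  rw [h, Finset.sum_image fun a _ b _ h => F_injective _ h]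
  simp [F_fixIndex]

open Classical in
theorem flux_zero {𝕜 : Type*} [RCLike 𝕜] (u : SG3 → 𝕜) (i : Fin 3) :
    flux 0 u i = ∑ a, (u (q i) - u (q a)) := by
  unfold flux
  rw [Finset.sum_filter]
  simp only [V, Adj]
  rw [Finset.sum_image fun a _ b _ h => q_injective h]
  refine Finset.sum_congr rfl fun a _ => ?_
  by_cases h : i = a
  · simp [h]
  · simp [q_injective.eq_iff, h]

section Extension

variable {𝕜 α : Type*} [RCLike 𝕜]

/-! ### Gluing functions on cells -/

/-- A family of functions on the six cells which agrees at common corners. -/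
def Compatible (g : Fin 6 → SG3 → α) : Prop :=
  ∀ i j a c, node i a = node j c → g i (q a) = g j (q c)

/-- The function on `SG₃` given by `g j` on the `j`-th cell. -/
def glue (g : Fin 6 → SG3 → α) (x : SG3) : α :=
  g (exists_F_eq x).choose (exists_F_eq x).choose_spec.choose

theorem glue_F {g : Fin 6 → SG3 → α} (hg : Compatible g) (j : Fin 6) (x : SG3) :
    glue g (F j x) = g j x := by
  have h := (exists_F_eq (F j x)).choose_spec.choose_spec
  unfold glue
  generalize (exists_F_eq (F j x)).choose_spec.choose = y at h ⊢
  generalize (exists_F_eq (F j x)).choose = i at h ⊢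
  by_cases hij : i = j
  · rw [hij] at h ⊢
    rw [F_injective j h]
  · obtain ⟨a, c, hac⟩ := exists_corner_of_ne hij
    obtain ⟨hy, hx⟩ := hac y x h
    rw [hy, hx] at h ⊢
    exact hg _ _ _ _ ((F_q_eq_iff _ _ _ _).1 h)

/-- The disjoint union of six copies of the compact space maps onto it by a closed continuous map,
which is a quotient map. -/
theorem continuous_of_comp_F {f : SG3 → 𝕜} (hf : ∀ j, Continuous (f ∘ F j)) : Continuous f := by
  have hπ : Continuous fun p : Fin 6 × SG3 => F p.1 p.2 :=
    continuous_prod_of_discrete_left.2 continuous_F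
  have hq : IsQuotientMap fun p : Fin 6 × SG3 => F p.1 p.2 :=
    hπ.isClosedMap.isQuotientMap hπ fun x => by
      obtain ⟨j, y, h⟩ := exists_F_eq x
      exact ⟨(j, y), h⟩
  exact hq.continuous_iff.2 (continuous_prod_of_discrete_left.2 hf)

theorem continuous_glue {g : Fin 6 → SG3 → 𝕜} (hg : Compatible g) (hc : ∀ j, Continuous (g j)) :
    Continuous (glue g) :=
  continuous_of_comp_F fun j => (hc j).congr fun x => (glue_F hg j x).symm

/-! ### The eigenfunction extension from the corners to the first graph -/

/-- The weight of the near corner in the extension to a side point. -/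
def nearWeight (x : 𝕜) : 𝕜 :=
  (3 * (4 - x) ^ 3 - 3 * (4 - x) ^ 2 - 11 * (4 - x) - 4) /
    (3 * (4 - 6 * x + x ^ 2) * (5 - x) * (3 - x))

/-- The weight of the far corner of the same side in the extension to a side point. -/
def farWeight (x : 𝕜) : 𝕜 := (16 - 3 * x) / (3 * (4 - 6 * x + x ^ 2) * (5 - x))

/-- The weight of the opposite corner in the extension to a side point. -/
def oppWeight (x : 𝕜) : 𝕜 := (36 - 7 * x) / (3 * (4 - 6 * x + x ^ 2) * (5 - x) * (3 - x))

/-- The weight of each corner in the extension to the center. -/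
def centerWeight (x : 𝕜) : 𝕜 := 4 / (3 * (4 - 6 * x + x ^ 2))

/-- The factor by which the extension multiplies discrete normal derivatives. -/
def fluxFactor (x : 𝕜) : 𝕜 :=
  (14 - 3 * x) * (6 - x) / (3 * (3 - x) * (5 - x) * (4 - 6 * x + x ^ 2))

/-- The value of the extension at a side point. -/
def sideValue (x p s t : 𝕜) : 𝕜 := nearWeight x * p + farWeight x * s + oppWeight x * t

/-- The values of the extension at the ten vertices of the first graph. -/
def nodeValue (x : 𝕜) (b : Fin 3 → 𝕜) : Fin 10 → 𝕜 :=
  ![b 0, b 1, b 2, sideValue x (b 0) (b 1) (b 2), sideValue x (b 0) (b 2) (b 1),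
    sideValue x (b 1) (b 0) (b 2), sideValue x (b 1) (b 2) (b 0), sideValue x (b 2) (b 0) (b 1),
    sideValue x (b 2) (b 1) (b 0), centerWeight x * (b 0 + b 1 + b 2)]

/-- The corner values on the `j`-th cell of the extension with parameter `x` of the corner
values `b`. -/
def extend (x : 𝕜) (b : Fin 3 → 𝕜) (j : Fin 6) (a : Fin 3) : 𝕜 := nodeValue x b (node j a)

theorem extend_fixIndex (x : 𝕜) (b : Fin 3 → 𝕜) (a : Fin 3) : extend x b (fixIndex a) a = b a := by
  fin_cases a <;> rfl

/-- The discrete normal derivative, corrected by the eigenvalue term. -/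
def cornerDeriv (x : 𝕜) (b : Fin 3 → 𝕜) (a : Fin 3) : 𝕜 := (3 - x / 2) * b a - ∑ c, b c

/-! ### Vertex equations of the extension -/

section Algebra

variable {x : 𝕜}

theorem sideValue_equation (hx : (5 - x) * (3 - x) * (4 - 6 * x + x ^ 2) ≠ 0) (p s t : 𝕜) :
    (4 - x) * sideValue x p s t =
      p + sideValue x p t s + sideValue x s p t + centerWeight x * (p + s + t) := by
  obtain ⟨⟨h5, h3⟩, hq⟩ : ((5 - x) ≠ 0 ∧ (3 - x) ≠ 0) ∧ (4 - 6 * x + x ^ 2) ≠ 0 := by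
    simpa [not_or] using hx
  unfold sideValue nearWeight farWeight oppWeight centerWeight
  generalize hQ : 4 - 6 * x + x ^ 2 = Q at hq ⊢
  field_simp
  rw [← hQ]
  ring

theorem center_equation (hx : (5 - x) * (3 - x) * (4 - 6 * x + x ^ 2) ≠ 0) (p s t : 𝕜) :
    (6 - 3 * x / 2) * (centerWeight x * (p + s + t)) =
      sideValue x p s t + sideValue x p t s + sideValue x s p t + sideValue x s t p +
        sideValue x t p s + sideValue x t s p := by
  obtain ⟨⟨h5, h3⟩, hq⟩ : ((5 - x) ≠ 0 ∧ (3 - x) ≠ 0) ∧ (4 - 6 * x + x ^ 2) ≠ 0 := by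
    simpa [not_or] using hx
  unfold sideValue nearWeight farWeight oppWeight centerWeight
  -- Every term carries the factor `1 / Q`, so the identity holds with `Q` treated as an independent
  -- variable.
  generalize 4 - 6 * x + x ^ 2 = Q at hq ⊢
  field_simp
  ring

theorem fluxFactor_mul (hx : (5 - x) * (3 - x) * (4 - 6 * x + x ^ 2) ≠ 0) {y : 𝕜}
    (hy : y * (14 - 3 * x) = 3 * x * (3 - x) * (4 - x) * (5 - x)) :
    fluxFactor x * y = x * (4 - x) * (6 - x) / (4 - 6 * x + x ^ 2) := by
  obtain ⟨⟨h5, h3⟩, hq⟩ : ((5 - x) ≠ 0 ∧ (3 - x) ≠ 0) ∧ (4 - 6 * x + x ^ 2) ≠ 0 := by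
    simpa [not_or] using hx
  unfold fluxFactor
  generalize 4 - 6 * x + x ^ 2 = Q at hq ⊢
  field_simp
  linear_combination (6 - x) * hy

theorem corner_equation (hx : (5 - x) * (3 - x) * (4 - 6 * x + x ^ 2) ≠ 0) {y : 𝕜}
    (hy : y * (14 - 3 * x) = 3 * x * (3 - x) * (4 - x) * (5 - x)) (p s t : 𝕜) :
    (2 - x / 2) * p - sideValue x p s t - sideValue x p t s =
      fluxFactor x * ((2 - y / 2) * p - s - t) := by
  have h := fluxFactor_mul hx hy
  -- The coarse parameter `y` enters only through `fluxFactor x * y`, which the decimation relation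
  -- turns into a rational function of `x`; what remains is an identity in `x`.
  have h2 : (2 - x / 2) * p - sideValue x p s t - sideValue x p t s =
      fluxFactor x * (2 * p - s - t) - x * (4 - x) * (6 - x) / (4 - 6 * x + x ^ 2) * p / 2 := by
    obtain ⟨⟨h5, h3⟩, hq⟩ : ((5 - x) ≠ 0 ∧ (3 - x) ≠ 0) ∧ (4 - 6 * x + x ^ 2) ≠ 0 := by
      simpa [not_or] using hx
    unfold sideValue nearWeight farWeight oppWeight fluxFactor
    generalize hQ : 4 - 6 * x + x ^ 2 = Q at hq ⊢
    field_simp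
    rw [← hQ]
    ring
  rw [h2, ← h]
  ring

/-- Replaces the values at shared cell corners by ten independent unknowns, so that a sum over cells
can be collected vertex by vertex. -/
theorem exists_node_values (U : SG3 → 𝕜) :
    ∃ W : Fin 10 → 𝕜, (∀ j a, U (F j (q a)) = W (node j a)) ∧ U (q 0) = W 0 ∧ U (q 1) = W 1 ∧
      U (q 2) = W 2 := by
  classical
  refine ⟨fun n => if h : ∃ p : Fin 6 × Fin 3, node p.1 p.2 = n then
    U (F h.choose.1 (q h.choose.2)) else 0, ?_⟩
  have key : ∀ j a, U (F j (q a)) = if h : ∃ p : Fin 6 × Fin 3, node p.1 p.2 = node j a then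
      U (F h.choose.1 (q h.choose.2)) else 0 := by
    intro j a
    have h : ∃ p : Fin 6 × Fin 3, node p.1 p.2 = node j a := ⟨(j, a), rfl⟩
    rw [dif_pos h, (F_q_eq_iff _ _ _ _).2 h.choose_spec]
  refine ⟨key, ?_, ?_, ?_⟩
  · conv_lhs => rw [← F_fixIndex 0]
    exact key _ _
  · conv_lhs => rw [← F_fixIndex 1]
    exact key _ _
  · conv_lhs => rw [← F_fixIndex 2]
    exact key _ _

/-- The extension satisfies the eigenvalue equation at the inner vertices of the first graph, and
multiplies the normal derivatives at the corners by `fluxFactor`. -/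
theorem sum_mul_cornerDeriv_extend (hx : (5 - x) * (3 - x) * (4 - 6 * x + x ^ 2) ≠ 0) {y : 𝕜}
    (hy : y * (14 - 3 * x) = 3 * x * (3 - x) * (4 - x) * (5 - x)) (U : SG3 → 𝕜)
    (b : Fin 3 → 𝕜) :
    ∑ j, ∑ a, U (F j (q a)) * cornerDeriv x (extend x b j) a =
      fluxFactor x * ∑ a, U (q a) * cornerDeriv y b a := by
  obtain ⟨W, hW, h0, h1, h2⟩ := exists_node_values U
  simp only [hW]
  simp only [Fin.sum_univ_three, Fin.sum_univ_six, cornerDeriv, extend, h0, h1, h2]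
  simp only [node, nodeValue, Matrix.cons_val]
  have c0 := corner_equation hx hy (b 0) (b 1) (b 2)
  have c1 := corner_equation hx hy (b 1) (b 0) (b 2)
  have c2 := corner_equation hx hy (b 2) (b 0) (b 1)
  have s3 := sideValue_equation hx (b 0) (b 1) (b 2)
  have s4 := sideValue_equation hx (b 0) (b 2) (b 1)
  have s5 := sideValue_equation hx (b 1) (b 0) (b 2)
  have s6 := sideValue_equation hx (b 1) (b 2) (b 0)
  have s7 := sideValue_equation hx (b 2) (b 0) (b 1)
  have s8 := sideValue_equation hx (b 2) (b 1) (b 0)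
  have s9 := center_equation hx (b 0) (b 1) (b 2)
  -- Each vertex equation is weighted by the value of `U` there. A side point lies in two cells and
  -- the center in three, whence the coefficients `4 - x` and `6 - 3 * x / 2`.
  linear_combination W 0 * c0 + W 1 * c1 + W 2 * c2 + W 3 * s3 + W 4 * s4 + W 5 * s5 +
    W 6 * s6 + W 7 * s7 + W 8 * s8 + W 9 * s9

end Algebra

/-! ### The harmonic extension -/

theorem nearWeight_zero : nearWeight (0 : 𝕜) = 8 / 15 := by norm_num [nearWeight]

theorem farWeight_zero : farWeight (0 : 𝕜) = 4 / 15 := by norm_num [farWeight]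

theorem oppWeight_zero : oppWeight (0 : 𝕜) = 3 / 15 := by norm_num [oppWeight]

theorem centerWeight_zero : centerWeight (0 : 𝕜) = 1 / 3 := by norm_num [centerWeight]

theorem fluxFactor_zero : fluxFactor (0 : 𝕜) = (r : 𝕜) := by
  unfold r
  push_cast
  norm_num [fluxFactor]

theorem norm_combination_le (s t w : ℝ) {ρ R : ℝ} (h : |s| + |t| + |w| ≤ ρ) {b : Fin 3 → 𝕜} {c : 𝕜}
    (hb : ∀ a, ‖b a - c‖ ≤ R) {z : 𝕜}
    (hz : z = (s : 𝕜) * (b 0 - c) + (t : 𝕜) * (b 1 - c) + (w : 𝕜) * (b 2 - c)) : ‖z‖ ≤ ρ * R := by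
  have hR : 0 ≤ R := (norm_nonneg _).trans (hb 0)
  have hm : ∀ (y : ℝ) (a : Fin 3), ‖(y : 𝕜) * (b a - c)‖ ≤ |y| * R := fun y a => by
    rw [norm_mul, RCLike.norm_ofReal]
    exact mul_le_mul_of_nonneg_left (hb a) (abs_nonneg y)
  calc ‖z‖ ≤ |s| * R + |t| * R + |w| * R := by
        rw [hz]
        exact norm_add₃_le.trans (add_le_add (add_le_add (hm s 0) (hm t 1)) (hm w 2))
    _ = (|s| + |t| + |w|) * R := by ring
    _ ≤ ρ * R := mul_le_mul_of_nonneg_right h hR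

theorem sideValue_zero (p s t : 𝕜) :
    sideValue 0 p s t = 8 / 15 * p + 4 / 15 * s + 3 / 15 * t := by
  rw [sideValue, nearWeight_zero, farWeight_zero, oppWeight_zero]

theorem norm_nodeValue_zero_sub_le {b : Fin 3 → 𝕜} {c : 𝕜} {R : ℝ} (hb : ∀ a, ‖b a - c‖ ≤ R)
    (n : Fin 10) : ‖nodeValue 0 b n - c‖ ≤ R := by
  rw [← one_mul R]
  have hside : ∀ (s t w : ℝ) (z : 𝕜), |s| + |t| + |w| ≤ 1 → z - c =
      (s : 𝕜) * (b 0 - c) + (t : 𝕜) * (b 1 - c) + (w : 𝕜) * (b 2 - c) → ‖z - c‖ ≤ 1 * R :=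
    fun s t w z h hz => norm_combination_le s t w h hb hz
  fin_cases n
  · exact hside 1 0 0 (b 0) (by norm_num [abs_of_pos])
      (by push_cast; ring)
  · exact hside 0 1 0 (b 1) (by norm_num [abs_of_pos])
      (by push_cast; ring)
  · exact hside 0 0 1 (b 2) (by norm_num [abs_of_pos])
      (by push_cast; ring)
  · exact hside (8 / 15) (4 / 15) (3 / 15) (sideValue 0 (b 0) (b 1) (b 2))
      (by norm_num [abs_of_pos]) (by rw [sideValue_zero]; push_cast; ring)
  · exact hside (8 / 15) (3 / 15) (4 / 15) (sideValue 0 (b 0) (b 2) (b 1))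
      (by norm_num [abs_of_pos]) (by rw [sideValue_zero]; push_cast; ring)
  · exact hside (4 / 15) (8 / 15) (3 / 15) (sideValue 0 (b 1) (b 0) (b 2))
      (by norm_num [abs_of_pos]) (by rw [sideValue_zero]; push_cast; ring)
  · exact hside (3 / 15) (8 / 15) (4 / 15) (sideValue 0 (b 1) (b 2) (b 0))
      (by norm_num [abs_of_pos]) (by rw [sideValue_zero]; push_cast; ring)
  · exact hside (4 / 15) (3 / 15) (8 / 15) (sideValue 0 (b 2) (b 0) (b 1))
      (by norm_num [abs_of_pos]) (by rw [sideValue_zero]; push_cast; ring)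
  · exact hside (3 / 15) (4 / 15) (8 / 15) (sideValue 0 (b 2) (b 1) (b 0))
      (by norm_num [abs_of_pos]) (by rw [sideValue_zero]; push_cast; ring)
  · exact hside (1 / 3) (1 / 3) (1 / 3) (centerWeight 0 * (b 0 + b 1 + b 2))
      (by norm_num [abs_of_pos]) (by rw [centerWeight_zero]; push_cast; ring)

theorem norm_extend_zero_sub_le {b : Fin 3 → 𝕜} {c : 𝕜} {R : ℝ} (hb : ∀ a, ‖b a - c‖ ≤ R)
    (j : Fin 6) (a : Fin 3) : ‖extend 0 b j a - c‖ ≤ R :=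
  norm_nodeValue_zero_sub_le hb _

/-- The harmonic extension contracts oscillations by the factor `7/15`. -/
theorem exists_norm_extend_zero_sub_le {b : Fin 3 → 𝕜} {c : 𝕜} {R : ℝ}
    (hb : ∀ a, ‖b a - c‖ ≤ R) (j : Fin 6) :
    ∃ c', ∀ a, ‖extend 0 b j a - c'‖ ≤ 7 / 15 * R := by
  have main : ∀ (s t w : ℝ) (z c' : 𝕜), |s| + |t| + |w| ≤ 7 / 15 → z - c' =
      (s : 𝕜) * (b 0 - c) + (t : 𝕜) * (b 1 - c) + (w : 𝕜) * (b 2 - c) →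
      ‖z - c'‖ ≤ 7 / 15 * R :=
    fun s t w z c' h hz => norm_combination_le s t w h hb hz
  fin_cases j
  -- In a corner cell all three values contain `8 / 15` of the fixed corner; removing this common
  -- part leaves weights of total `7 / 15`.
  · refine ⟨(8 / 15 * b 0 + 7 / 15 * c), fun a => ?_⟩
    fin_cases a
    · exact main (7 / 15) 0 0 (b 0) _ (by norm_num [abs_of_pos])
        (by push_cast; ring)
    · exact main 0 (4 / 15) (3 / 15) (sideValue 0 (b 0) (b 1) (b 2)) _
        (by norm_num [abs_of_pos]) (by rw [sideValue_zero]; push_cast; ring)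
    · exact main 0 (3 / 15) (4 / 15) (sideValue 0 (b 0) (b 2) (b 1)) _
        (by norm_num [abs_of_pos]) (by rw [sideValue_zero]; push_cast; ring)
  · refine ⟨(8 / 15 * b 1 + 7 / 15 * c), fun a => ?_⟩
    fin_cases a
    · exact main (4 / 15) 0 (3 / 15) (sideValue 0 (b 1) (b 0) (b 2)) _
        (by norm_num [abs_of_pos]) (by rw [sideValue_zero]; push_cast; ring)
    · exact main 0 (7 / 15) 0 (b 1) _ (by norm_num [abs_of_pos])
        (by push_cast; ring)
    · exact main (3 / 15) 0 (4 / 15) (sideValue 0 (b 1) (b 2) (b 0)) _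
        (by norm_num [abs_of_pos]) (by rw [sideValue_zero]; push_cast; ring)
  · refine ⟨(8 / 15 * b 2 + 7 / 15 * c), fun a => ?_⟩
    fin_cases a
    · exact main (4 / 15) (3 / 15) 0 (sideValue 0 (b 2) (b 0) (b 1)) _
        (by norm_num [abs_of_pos]) (by rw [sideValue_zero]; push_cast; ring)
    · exact main (3 / 15) (4 / 15) 0 (sideValue 0 (b 2) (b 1) (b 0)) _
        (by norm_num [abs_of_pos]) (by rw [sideValue_zero]; push_cast; ring)
    · exact main 0 0 (7 / 15) (b 2) _ (by norm_num [abs_of_pos])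
        (by push_cast; ring)
  -- In a middle cell the new center is the value at the central vertex; the deviations have total
  -- weight at most `6 / 15`.
  · refine ⟨((b 0 + b 1 + b 2) / 3), fun a => ?_⟩
    fin_cases a
    · exact main 0 0 0 (centerWeight 0 * (b 0 + b 1 + b 2)) _
        (by norm_num [abs_of_pos]) (by rw [centerWeight_zero]; push_cast; ring)
    · exact main (-2 / 15) (3 / 15) (-1 / 15) (sideValue 0 (b 1) (b 2) (b 0)) _
        (by norm_num [abs_of_pos]) (by rw [sideValue_zero]; push_cast; ring)
    · exact main (-2 / 15) (-1 / 15) (3 / 15) (sideValue 0 (b 2) (b 1) (b 0)) _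
        (by norm_num [abs_of_pos]) (by rw [sideValue_zero]; push_cast; ring)
  · refine ⟨((b 0 + b 1 + b 2) / 3), fun a => ?_⟩
    fin_cases a
    · exact main (3 / 15) (-2 / 15) (-1 / 15) (sideValue 0 (b 0) (b 2) (b 1)) _
        (by norm_num [abs_of_pos]) (by rw [sideValue_zero]; push_cast; ring)
    · exact main 0 0 0 (centerWeight 0 * (b 0 + b 1 + b 2)) _
        (by norm_num [abs_of_pos]) (by rw [centerWeight_zero]; push_cast; ring)
    · exact main (-1 / 15) (-2 / 15) (3 / 15) (sideValue 0 (b 2) (b 0) (b 1)) _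
        (by norm_num [abs_of_pos]) (by rw [sideValue_zero]; push_cast; ring)
  · refine ⟨((b 0 + b 1 + b 2) / 3), fun a => ?_⟩
    fin_cases a
    · exact main (3 / 15) (-1 / 15) (-2 / 15) (sideValue 0 (b 0) (b 1) (b 2)) _
        (by norm_num [abs_of_pos]) (by rw [sideValue_zero]; push_cast; ring)
    · exact main (-1 / 15) (3 / 15) (-2 / 15) (sideValue 0 (b 1) (b 0) (b 2)) _
        (by norm_num [abs_of_pos]) (by rw [sideValue_zero]; push_cast; ring)
    · exact main 0 0 0 (centerWeight 0 * (b 0 + b 1 + b 2)) _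
        (by norm_num [abs_of_pos]) (by rw [centerWeight_zero]; push_cast; ring)

end Extension

/-! ### Iterated extensions and harmonic functions -/

section Cascade

variable {𝕜 : Type*} [RCLike 𝕜]

/-- Extend corner values by `m` steps with the parameters `l 1, …, l m`, and fill in the cells of
level `m` by means of `base`. -/
def cascade (base : (Fin 3 → 𝕜) → SG3 → 𝕜) : (ℕ → 𝕜) → ℕ → (Fin 3 → 𝕜) → SG3 → 𝕜
  | _, 0, b => base b
  | l, m + 1, b => glue fun j => cascade base (fun k => l (k + 1)) m (extend (l 1) b j)

section

variable {base : (Fin 3 → 𝕜) → SG3 → 𝕜}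

/-- The two claims need a joint induction: gluing at one level requires compatibility, which follows
from the corner values at that level. -/
theorem cascade_q_and_compatible (hq : ∀ b a, base b (q a) = b a) (m : ℕ) :
    ∀ (l : ℕ → 𝕜) (b : Fin 3 → 𝕜), (∀ a, cascade base l m b (q a) = b a) ∧
      Compatible fun j => cascade base (fun k => l (k + 1)) m (extend (l 1) b j) := by
  induction m with
  | zero =>
    refine fun l b => ⟨hq b, fun i j a c h => ?_⟩
    simp only [cascade, hq, extend, h]
  | succ m ih =>
    have h1 : ∀ (l : ℕ → 𝕜) (b : Fin 3 → 𝕜) a, cascade base l (m + 1) b (q a) = b a := by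
      intro l b a
      rw [← F_fixIndex a, cascade, glue_F (ih l b).2, (ih _ _).1, extend_fixIndex]
    refine fun l b => ⟨h1 l b, fun i j a c h => ?_⟩
    simp only [h1, extend, h]

theorem cascade_q (hq : ∀ b a, base b (q a) = b a) (l : ℕ → 𝕜) (m : ℕ) (b : Fin 3 → 𝕜) (a : Fin 3) :
    cascade base l m b (q a) = b a :=
  (cascade_q_and_compatible hq m l b).1 a

theorem cascade_succ_F (hq : ∀ b a, base b (q a) = b a) (l : ℕ → 𝕜) (m : ℕ)
    (b : Fin 3 → 𝕜) (j : Fin 6) (x : SG3) :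
    cascade base l (m + 1) b (F j x) =
      cascade base (fun k => l (k + 1)) m (extend (l 1) b j) x :=
  glue_F (cascade_q_and_compatible hq m l b).2 j x

theorem continuous_cascade (hq : ∀ b a, base b (q a) = b a)
    (hc : ∀ b, Continuous (base b)) (m : ℕ) :
    ∀ (l : ℕ → 𝕜) (b : Fin 3 → 𝕜), Continuous (cascade base l m b) := by
  induction m with
  | zero => exact fun _ => hc
  | succ m ih =>
    exact fun l b => continuous_glue (cascade_q_and_compatible hq m l b).2 fun j => ih _ _

theorem norm_cascade_zero_sub_le (hq : ∀ b a, base b (q a) = b a)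
    (hb : ∀ b c R, (∀ a, ‖b a - c‖ ≤ R) → ∀ x, ‖base b x - c‖ ≤ R) (m : ℕ) :
    ∀ (b : Fin 3 → 𝕜) (c : 𝕜) (R : ℝ), (∀ a, ‖b a - c‖ ≤ R) →
      ∀ x, ‖cascade base (fun _ => 0) m b x - c‖ ≤ R := by
  induction m with
  | zero => exact hb
  | succ m ih =>
    intro b c R h x
    obtain ⟨j, y, rfl⟩ := exists_F_eq x
    rw [cascade_succ_F hq]
    exact ih _ _ _ (norm_extend_zero_sub_le h j) y

end

/-- The affine function with given corner values. -/
def affine (b : Fin 3 → 𝕜) (x : SG3) : 𝕜 := ∑ k, (((x : Ambient) k : ℝ) : 𝕜) * b k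

theorem affine_q (b : Fin 3 → 𝕜) (a : Fin 3) : affine b (q a) = b a := by
  simp [affine, coe_q_apply]

theorem continuous_affine (b : Fin 3 → 𝕜) : Continuous (affine b) := by
  unfold affine
  fun_prop

theorem norm_affine_sub_le (b : Fin 3 → 𝕜) (c : 𝕜) (R : ℝ) (h : ∀ a, ‖b a - c‖ ≤ R) (x : SG3) :
    ‖affine b x - c‖ ≤ R := by
  have h1 : affine b x - c = ∑ k, (((x : Ambient) k : ℝ) : 𝕜) * (b k - c) := by
    simp only [mul_sub, Finset.sum_sub_distrib, ← Finset.sum_mul, ← RCLike.ofReal_sum, sum_coord]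
    simp [affine]
  rw [h1]
  calc ‖∑ k, (((x : Ambient) k : ℝ) : 𝕜) * (b k - c)‖ ≤ ∑ k, (x : Ambient) k * R := by
        refine norm_sum_le_of_le _ fun k _ => ?_
        rw [norm_mul, RCLike.norm_ofReal, abs_of_nonneg (coord_nonneg x k)]
        exact mul_le_mul_of_nonneg_left (h k) (coord_nonneg x k)
    _ = R := by rw [← Finset.sum_mul, sum_coord, one_mul]

/-- On a cell of level `n` the corner values lie in a ball of radius `(7 / 15) ^ n * R`, and neither
filling leaves that ball. -/
theorem norm_cascade_affine_succ_sub_le (n : ℕ) :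
    ∀ (b : Fin 3 → 𝕜) (R : ℝ), (∃ c, ∀ a, ‖b a - c‖ ≤ R) → ∀ x,
      ‖cascade affine (fun _ => 0) n b x - cascade affine (fun _ => 0) (n + 1) b x‖ ≤
        2 * R * (7 / 15) ^ n := by
  induction n with
  | zero =>
    rintro b R ⟨c, hc⟩ x
    have h0 := norm_cascade_zero_sub_le affine_q norm_affine_sub_le 0 b c R hc x
    have h1 := norm_cascade_zero_sub_le affine_q norm_affine_sub_le 1 b c R hc x
    rw [← sub_sub_sub_cancel_right _ _ c]
    refine (norm_sub_le _ _).trans ?_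
    simp only [zero_add, pow_zero]
    linarith
  | succ n ih =>
    rintro b R ⟨c, hc⟩ x
    obtain ⟨j, y, rfl⟩ := exists_F_eq x
    rw [cascade_succ_F affine_q, cascade_succ_F affine_q]
    refine (ih _ _ (exists_norm_extend_zero_sub_le hc j) y).trans (le_of_eq ?_)
    ring

/-- Existence of the harmonic functions with given corner values. -/
theorem exists_harmonic : ∃ H : (Fin 3 → 𝕜) → SG3 → 𝕜, (∀ b, Continuous (H b)) ∧
    (∀ b a, H b (q a) = b a) ∧ (∀ b j x, H b (F j x) = H (extend 0 b j) x) ∧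
    ∀ b c R, (∀ a, ‖b a - c‖ ≤ R) → ∀ x, ‖H b x - c‖ ≤ R := by
  let G : ℕ → (Fin 3 → 𝕜) → C(SG3, 𝕜) := fun n b =>
    ⟨cascade affine (fun _ => 0) n b, continuous_cascade affine_q continuous_affine n _ b⟩
  have hlim : ∀ b, ∃ f, Tendsto (fun n => G n b) atTop (𝓝 f) := by
    intro b
    refine cauchySeq_tendsto_of_complete
      (cauchySeq_of_le_geometric (7 / 15) (2 * ‖b‖) (by norm_num) fun n => ?_)
    rw [ContinuousMap.dist_le (by positivity)]
    intro x
    rw [dist_eq_norm]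
    exact norm_cascade_affine_succ_sub_le n b ‖b‖
      ⟨0, fun a => by simpa using norm_le_pi_norm b a⟩ x
  choose H hH using hlim
  have hx : ∀ b x, Tendsto (fun n => cascade affine (fun _ => 0) n b x) atTop (𝓝 (H b x)) :=
    fun b x => ((ContinuousEval.continuous_eval.comp
      (Continuous.prodMk_left x)).tendsto (H b)).comp (hH b)
  refine ⟨fun b => H b, fun b => (H b).continuous, fun b a => ?_, fun b j x => ?_,
    fun b c R h x => ?_⟩
  · refine tendsto_nhds_unique (hx b (q a)) ?_
    simp only [cascade_q affine_q]
    exact tendsto_const_nhds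
  · refine tendsto_nhds_unique ((hx b (F j x)).comp (tendsto_add_atTop_nat 1)) ?_
    refine (hx (extend 0 b j) x).congr fun n => ?_
    exact (cascade_succ_F affine_q (fun _ => 0) n b j x).symm
  · exact le_of_tendsto ((hx b x).sub_const c).norm
      (Eventually.of_forall fun n =>
        norm_cascade_zero_sub_le affine_q norm_affine_sub_le n b c R h x)

/-- The harmonic function with given corner values. -/
def harmonic : (Fin 3 → 𝕜) → SG3 → 𝕜 := exists_harmonic.choose

theorem continuous_harmonic (b : Fin 3 → 𝕜) : Continuous (harmonic b) :=
  exists_harmonic.choose_spec.1 b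

theorem harmonic_q (b : Fin 3 → 𝕜) (a : Fin 3) : harmonic b (q a) = b a :=
  exists_harmonic.choose_spec.2.1 b a

theorem harmonic_F (b : Fin 3 → 𝕜) (j : Fin 6) (x : SG3) :
    harmonic b (F j x) = harmonic (extend 0 b j) x :=
  exists_harmonic.choose_spec.2.2.1 b j x

theorem norm_harmonic_sub_le {b : Fin 3 → 𝕜} {c : 𝕜} {R : ℝ} (h : ∀ a, ‖b a - c‖ ≤ R) (x : SG3) :
    ‖harmonic b x - c‖ ≤ R :=
  exists_harmonic.choose_spec.2.2.2 b c R h x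

theorem norm_harmonic_le (b : Fin 3 → 𝕜) (x : SG3) : ‖harmonic b x‖ ≤ ‖b‖ := by
  simpa using norm_harmonic_sub_le (b := b) (c := 0) (R := ‖b‖)
    (fun a => by simpa using norm_le_pi_norm b a) x

/-! ### Integrals of harmonic functions -/

theorem integrable_of_continuous {f : SG3 → 𝕜} (hf : Continuous f) : Integrable f mu :=
  hf.integrable_of_hasCompactSupport (HasCompactSupport.of_compactSpace f)

theorem sum_extend_zero (b : Fin 3 → 𝕜) : ∑ j, ∑ a, extend 0 b j a = 6 * ∑ a, b a := by
  simp only [Fin.sum_univ_three, Fin.sum_univ_six, extend]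
  simp only [node, nodeValue, Matrix.cons_val, sideValue_zero, centerWeight_zero]
  ring

/-- Harmonic extension preserves the mean over cell corners (`sum_extend_zero`), so the error is the
average of the errors on the cells, where the oscillation is smaller by `7 / 15`. -/
theorem norm_integral_harmonic_sub_le (n : ℕ) : ∀ (b : Fin 3 → 𝕜) (R : ℝ),
    (∃ c, ∀ a, ‖b a - c‖ ≤ R) →
      ‖∫ x, harmonic b x ∂mu - 1 / 3 * ∑ a, b a‖ ≤ 2 * R * (7 / 15) ^ n := by
  induction n with
  | zero =>
    rintro b R ⟨c, hc⟩
    have h1 : ‖∫ x, (harmonic b x - c) ∂mu‖ ≤ R := by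
      simpa using norm_integral_le_of_norm_le_const (μ := mu)
        (Eventually.of_forall (norm_harmonic_sub_le hc))
    have h2 : ‖1 / 3 * ∑ a, b a - c‖ ≤ 1 * R :=
      norm_combination_le (1 / 3) (1 / 3) (1 / 3) (by norm_num [abs_of_pos]) hc
        (by rw [Fin.sum_univ_three]; push_cast; ring)
    rw [integral_sub (integrable_of_continuous (continuous_harmonic b)) (integrable_const c)] at h1
    simp only [integral_const, probReal_univ, one_smul] at h1
    rw [← sub_sub_sub_cancel_right _ _ c]
    refine (norm_sub_le _ _).trans ?_
    rw [pow_zero]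
    linarith
  | succ n ih =>
    rintro b R ⟨c, hc⟩
    have h1 : ∫ x, harmonic b x ∂mu - 1 / 3 * ∑ a, b a =
        1 / 6 * ∑ j, (∫ x, harmonic (extend 0 b j) x ∂mu - 1 / 3 * ∑ a, extend 0 b j a) := by
      rw [integral_eq_sum_cells (continuous_harmonic b), Finset.sum_sub_distrib,
        ← Finset.mul_sum, sum_extend_zero]
      simp only [harmonic_F]
      ring
    rw [h1, norm_mul]
    have h2 : ‖∑ j, (∫ x, harmonic (extend 0 b j) x ∂mu - 1 / 3 * ∑ a, extend 0 b j a)‖ ≤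
        ∑ _j : Fin 6, 2 * (7 / 15 * R) * (7 / 15) ^ n :=
      norm_sum_le_of_le _ fun j _ => ih _ _ (exists_norm_extend_zero_sub_le hc j)
    have h3 : ‖(1 / 6 : 𝕜)‖ = 1 / 6 := by simp
    rw [h3]
    simp only [Finset.sum_const, Finset.card_univ, Fintype.card_fin, nsmul_eq_mul] at h2
    rw [pow_succ]
    push_cast at h2
    linarith

theorem integral_harmonic (b : Fin 3 → 𝕜) : ∫ x, harmonic b x ∂mu = 1 / 3 * ∑ a, b a := by
  have hb : ∃ c : 𝕜, ∀ a, ‖b a - c‖ ≤ ‖b‖ := ⟨0, fun a => by simpa using norm_le_pi_norm b a⟩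
  have hlim : Tendsto (fun n : ℕ => 2 * ‖b‖ * (7 / 15 : ℝ) ^ n) atTop (𝓝 0) := by
    simpa using (tendsto_pow_atTop_nhds_zero_of_lt_one
      (by norm_num : (0 : ℝ) ≤ 7 / 15) (by norm_num)).const_mul (2 * ‖b‖)
  have h := ge_of_tendsto' hlim fun n => norm_integral_harmonic_sub_le n b ‖b‖ hb
  exact sub_eq_zero.1 (norm_le_zero_iff.1 h)

end Cascade

section Energy

variable {𝕜 : Type*} [RCLike 𝕜]

/-! ### Unnormalized energies and splines -/

/-- The graph energy without the renormalization. -/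
def rawEnergy (m : ℕ) (u v : SG3 → 𝕜) : 𝕜 :=
  1 / 2 * ∑ p ∈ edges m, (u p.1 - u p.2) * (v p.1 - v p.2)

theorem graphEnergy_eq (m : ℕ) (u v : SG3 → 𝕜) :
    graphEnergy m u v = ((r⁻¹ ^ m : ℝ) : 𝕜) * rawEnergy m u v := by
  rw [graphEnergy, rawEnergy, sum_adj_eq_sum_edges m fun x y => (u x - u y) * (v x - v y)]
  push_cast
  ring

theorem rawEnergy_succ (m : ℕ) (u v : SG3 → 𝕜) :
    rawEnergy (m + 1) u v = ∑ j, rawEnergy m (u ∘ F j) (v ∘ F j) := by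
  unfold rawEnergy
  rw [sum_edges_succ m fun x y => (u x - u y) * (v x - v y), Finset.mul_sum]
  rfl

theorem rawEnergy_sub_right (m : ℕ) (u v w : SG3 → 𝕜) :
    rawEnergy m u (fun x => v x - w x) = rawEnergy m u v - rawEnergy m u w := by
  unfold rawEnergy
  rw [← mul_sub, ← Finset.sum_sub_distrib]
  congr 1
  exact Finset.sum_congr rfl fun p _ => by ring

theorem rawEnergy_zero_right (m : ℕ) (u : SG3 → 𝕜) : rawEnergy m u (fun _ => 0) = 0 := by
  simp [rawEnergy]

theorem rawEnergy_zero (u v : SG3 → 𝕜) :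
    rawEnergy 0 u v = ∑ a, u (q a) * cornerDeriv 0 (v ∘ q) a := by
  unfold rawEnergy
  rw [sum_edges_zero fun x y => (u x - u y) * (v x - v y)]
  simp only [Fin.sum_univ_three, cornerDeriv, Function.comp]
  ring

/-- Functions whose energy is determined by the `m`-th graph. -/
def IsSpline (m : ℕ) (v : SG3 → 𝕜) : Prop :=
  ∀ k u, rawEnergy (m + k) u v = (r : 𝕜) ^ k * rawEnergy m u v

theorem IsSpline.sub {m : ℕ} {v w : SG3 → 𝕜} (hv : IsSpline m v) (hw : IsSpline m w) :
    IsSpline m fun x => v x - w x := by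
  intro k u
  rw [rawEnergy_sub_right, rawEnergy_sub_right, hv, hw, mul_sub]

theorem isSpline_zero (m : ℕ) : IsSpline m fun _ => (0 : 𝕜) := by
  intro k u
  simp [rawEnergy_zero_right]

theorem IsSpline.of_comp_F {m : ℕ} {v : SG3 → 𝕜} (hv : ∀ j, IsSpline m (v ∘ F j)) :
    IsSpline (m + 1) v := by
  intro k u
  rw [show m + 1 + k = m + k + 1 by omega, rawEnergy_succ, rawEnergy_succ, Finset.mul_sum]
  exact Finset.sum_congr rfl fun j _ => hv j k _

theorem isSpline_harmonic (b : Fin 3 → 𝕜) : IsSpline 0 (harmonic b) := by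
  intro k
  rw [zero_add]
  induction k generalizing b with
  | zero => intro u; simp
  | succ k ih =>
    intro u
    have hF : ∀ j, harmonic b ∘ F j = harmonic (extend 0 b j) := fun j => funext (harmonic_F b j)
    have hq : ∀ b : Fin 3 → 𝕜, harmonic b ∘ q = b := fun b => funext (harmonic_q b)
    have h0 : (5 - (0 : 𝕜)) * (3 - 0) * (4 - 6 * 0 + 0 ^ 2) ≠ 0 := by norm_num
    have key := sum_mul_cornerDeriv_extend h0 (y := 0) (by simp) u b
    rw [rawEnergy_succ]
    simp only [hF, ih, rawEnergy_zero, hq, Function.comp_apply]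
    rw [← Finset.mul_sum, key, fluxFactor_zero]
    ring

theorem IsSpline.inDomEnergy {m : ℕ} {v : SG3 → 𝕜} (hv : IsSpline m v) (hc : Continuous v) :
    InDomEnergy v := by
  refine ⟨hc, ?_⟩
  have hr : (0 : ℝ) < r := by norm_num [r]
  set Q : ℕ → ℝ := fun k => r⁻¹ ^ k * (1 / 2) * ∑ p ∈ edges k, ‖v p.1 - v p.2‖ ^ 2 with hQ
  -- The spline property holds against every function; the conjugate of `v` turns the bilinear form
  -- into the sum of squared norms.
  have hcast : ∀ k, (Q k : 𝕜) =
      ((r⁻¹ ^ k : ℝ) : 𝕜) * rawEnergy k (fun x => (starRingEnd 𝕜) (v x)) v := by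
    intro k
    simp only [hQ, rawEnergy, ← map_sub, RCLike.conj_mul]
    push_cast
    ring
  have hconst : ∀ k, Q (m + k) = Q m := by
    intro k
    apply RCLike.ofReal_injective (K := 𝕜)
    rw [hcast, hcast, hv, ← mul_assoc]
    congr 1
    rw [← RCLike.ofReal_pow, ← RCLike.ofReal_mul]
    congr 1
    rw [pow_add, mul_assoc, ← mul_pow, inv_mul_cancel₀ hr.ne', one_pow, mul_one]
  have hbdd : BddAbove (Set.range Q) := by
    refine Tendsto.bddAbove_range (a := Q m) ?_
    refine tendsto_const_nhds.congr' ?_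
    filter_upwards [eventually_ge_atTop m] with k hk
    rw [← hconst (k - m), Nat.add_sub_cancel' hk]
  convert hbdd using 2
  funext k
  simp only [hQ]
  rw [sum_adj_eq_sum_edges k fun x y => ‖v x - v y‖ ^ 2]

/-- Against a spline the factor `r ^ k` cancels the renormalization, so the limit in the weak
equation is already attained at level `m`. -/
theorem HasLaplacian.graphEnergy_spline {u f v : SG3 → 𝕜} (hu : HasLaplacian u f) {m : ℕ}
    (hv : IsSpline m v) (hc : Continuous v) (h0 : ∀ i, v (q i) = 0) :
    graphEnergy m u v = -∫ x, f x * v x ∂mu := by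
  refine tendsto_nhds_unique ?_ (hu.2.2 v (hv.inDomEnergy hc) h0)
  refine tendsto_const_nhds.congr' ?_
  filter_upwards [eventually_ge_atTop m] with k hk
  obtain ⟨k, rfl⟩ := Nat.exists_eq_add_of_le hk
  have hr : r ≠ 0 := by norm_num [r]
  rw [graphEnergy_eq, graphEnergy_eq, hv, ← mul_assoc]
  congr 1
  rw [← RCLike.ofReal_pow, ← RCLike.ofReal_mul]
  congr 1
  rw [pow_add, mul_assoc, ← mul_pow, inv_mul_cancel₀ hr, one_pow, mul_one]

/-! ### Spikes at the corners -/

/-- The spline of level `m` which is `1` at the corner `q i` and `0` at the other vertices. -/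
def spike (i : Fin 3) : ℕ → SG3 → 𝕜
  | 0 => harmonic (Pi.single i 1)
  | m + 1 => glue fun j => if j = fixIndex i then spike i m else fun _ => 0

theorem spike_q_and_compatible (i : Fin 3) (m : ℕ) :
    (∀ a, (spike i m (q a) : 𝕜) = Pi.single (M := fun _ => 𝕜) i 1 a) ∧
      Compatible fun j => if j = fixIndex i then spike (𝕜 := 𝕜) i m else fun _ => 0 := by
  -- A vertex of the first graph that equals `q i` has only one representation as a cell corner.
  have key : ∀ (i : Fin 3) (j j' : Fin 6) (a c : Fin 3), node j a = node j' c →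
      (j = fixIndex i ∧ a = i ↔ j' = fixIndex i ∧ c = i) := by decide
  have hcomp : ∀ f : SG3 → 𝕜, (∀ a, f (q a) = Pi.single (M := fun _ => 𝕜) i 1 a) →
      Compatible fun j => if j = fixIndex i then f else fun _ => 0 := by
    intro f hf
    have h : ∀ j a, (if j = fixIndex i then f else fun _ => 0) (q a) =
        if j = fixIndex i ∧ a = i then 1 else 0 := by
      intro j a
      by_cases hj : j = fixIndex i
      · simp [hj, hf, Pi.single_apply]
      · simp [hj]
    intro j j' a c hac
    simp only [h, key i j j' a c hac]
  have hq : ∀ a, (spike i m (q a) : 𝕜) = Pi.single (M := fun _ => 𝕜) i 1 a := by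
    induction m with
    | zero => exact harmonic_q _
    | succ m ih =>
      intro a
      rw [← F_fixIndex a, spike, glue_F (hcomp _ ih)]
      by_cases h : a = i
      · simp [h, ih]
      · simp [h, fixIndex_injective.eq_iff]
  exact ⟨hq, hcomp _ hq⟩

theorem spike_succ_F (i : Fin 3) (m : ℕ) (j : Fin 6) (x : SG3) :
    (spike i (m + 1) (F j x) : 𝕜) = if j = fixIndex i then spike i m x else 0 := by
  rw [spike, glue_F (spike_q_and_compatible i m).2]
  split_ifs <;> rfl

theorem continuous_spike (i : Fin 3) (m : ℕ) : Continuous (spike i m : SG3 → 𝕜) := by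
  induction m with
  | zero => exact continuous_harmonic _
  | succ m ih =>
    refine continuous_glue (spike_q_and_compatible i m).2 fun j => ?_
    split_ifs
    exacts [ih, continuous_const]

theorem spike_succ_comp_F (i : Fin 3) (m : ℕ) (j : Fin 6) :
    (spike i (m + 1) : SG3 → 𝕜) ∘ F j = if j = fixIndex i then spike i m else fun _ => 0 := by
  funext x
  rw [Function.comp_apply, spike_succ_F]
  split_ifs <;> rfl

theorem isSpline_spike (i : Fin 3) (m : ℕ) : IsSpline m (spike i m : SG3 → 𝕜) := by
  induction m with
  | zero => exact isSpline_harmonic _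
  | succ m ih =>
    refine IsSpline.of_comp_F fun j => ?_
    rw [spike_succ_comp_F]
    split_ifs
    exacts [ih, isSpline_zero m]

theorem rawEnergy_spike (i : Fin 3) (m : ℕ) (u : SG3 → 𝕜) :
    rawEnergy m u (spike i m) = flux m u i := by
  induction m generalizing u with
  | zero =>
    have hq : spike (𝕜 := 𝕜) i 0 ∘ q = Pi.single i 1 := funext (spike_q_and_compatible i 0).1
    rw [rawEnergy_zero, flux_zero, hq]
    simp only [cornerDeriv, Finset.sum_pi_single', mul_sub, Finset.sum_sub_distrib]
    simp [Pi.single_apply]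
    ring
  | succ m ih =>
    rw [rawEnergy_succ, flux_succ, Finset.sum_eq_single (fixIndex i)]
    · rw [spike_succ_comp_F, if_pos rfl, ih]
    · intro j _ hj
      rw [spike_succ_comp_F, if_neg hj, rawEnergy_zero_right]
    · simp

/-- The spike is supported on one cell of measure `(1 / 6) ^ m` and is bounded by 1. -/
theorem norm_integral_mul_spike_le (i : Fin 3) (m : ℕ) : ∀ {u : SG3 → 𝕜} {C : ℝ},
    Continuous u → (∀ x, ‖u x‖ ≤ C) →
      ‖∫ x, u x * spike i m x ∂mu‖ ≤ C * (1 / 6) ^ m := by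
  induction m with
  | zero =>
    intro u C hu hC
    have h : ∀ x, ‖u x * spike i 0 x‖ ≤ C := by
      intro x
      rw [norm_mul]
      have h1 : ‖(spike i 0 x : 𝕜)‖ ≤ 1 := by
        refine (norm_harmonic_le _ x).trans ?_
        rw [Pi.norm_single, norm_one]
      have := hC x
      nlinarith [norm_nonneg (u x)]
    simpa using norm_integral_le_of_norm_le_const (μ := mu) (Eventually.of_forall h)
  | succ m ih =>
    intro u C hu hC
    rw [integral_eq_sum_cells (f := fun x => u x * spike i (m + 1) x)
      (hu.mul (continuous_spike i _)), Finset.sum_eq_single (fixIndex i)]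
    · have := ih (hu.comp (continuous_F (fixIndex i))) fun x => hC (F (fixIndex i) x)
      simp only [spike_succ_F, if_pos, norm_mul]
      have h3 : ‖(1 / 6 : 𝕜)‖ = 1 / 6 := by simp
      rw [h3, pow_succ]
      simp only [Function.comp_apply] at this
      linarith
    · intro j _ hj
      simp [spike_succ_F, hj]
    · simp

end Energy

section Decimation

variable {𝕜 : Type*} [RCLike 𝕜]

/-! ### Splines obtained by decimation -/

/-- The spline of level `m` obtained from corner values by the eigenfunction extensions with
parameters `l 1, …, l m`. -/
def decimated (l : ℕ → 𝕜) (m : ℕ) (b : Fin 3 → 𝕜) : SG3 → 𝕜 := cascade harmonic l m b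

theorem decimated_zero (l : ℕ → 𝕜) (b : Fin 3 → 𝕜) : decimated l 0 b = harmonic b := rfl

theorem decimated_q (l : ℕ → 𝕜) (m : ℕ) (b : Fin 3 → 𝕜) (a : Fin 3) :
    decimated l m b (q a) = b a :=
  cascade_q harmonic_q l m b a

theorem decimated_succ_F (l : ℕ → 𝕜) (m : ℕ) (b : Fin 3 → 𝕜) (j : Fin 6) (x : SG3) :
    decimated l (m + 1) b (F j x) = decimated (fun k => l (k + 1)) m (extend (l 1) b j) x :=
  cascade_succ_F harmonic_q l m b j x

theorem decimated_succ_comp_F (l : ℕ → 𝕜) (m : ℕ) (b : Fin 3 → 𝕜) (j : Fin 6) :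
    decimated l (m + 1) b ∘ F j = decimated (fun k => l (k + 1)) m (extend (l 1) b j) :=
  funext (decimated_succ_F l m b j)

theorem continuous_decimated (l : ℕ → 𝕜) (m : ℕ) (b : Fin 3 → 𝕜) :
    Continuous (decimated l m b) :=
  continuous_cascade harmonic_q continuous_harmonic m l b

theorem isSpline_decimated (m : ℕ) : ∀ (l : ℕ → 𝕜) (b : Fin 3 → 𝕜),
    IsSpline m (decimated l m b) := by
  induction m with
  | zero => exact fun _ => isSpline_harmonic
  | succ m ih =>
    refine fun l b => IsSpline.of_comp_F fun j => ?_
    rw [decimated_succ_comp_F]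
    exact ih _ _

/-! ### The discrete Green formula -/

/-- The sum of the values of `f` over the corners of all cells of level `m`. -/
def vertexSum : ℕ → (SG3 → 𝕜) → 𝕜
  | 0, f => ∑ a, f (q a)
  | m + 1, f => ∑ j, vertexSum m (f ∘ F j)

/-- Each decimation step turns the corner terms of the finer cells into those of the coarser one,
times `fluxFactor`. The eigenvalue term weights a vertex by the number of cells containing it, as
`vertexSum` does. -/
theorem rawEnergy_decimated (m : ℕ) : ∀ (l : ℕ → 𝕜),
    (∀ k, l k * (14 - 3 * l (k + 1)) =
      3 * l (k + 1) * (3 - l (k + 1)) * (4 - l (k + 1)) * (5 - l (k + 1))) →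
    (∀ k, (5 - l (k + 1)) * (3 - l (k + 1)) * (4 - 6 * l (k + 1) + l (k + 1) ^ 2) ≠ 0) →
    ∀ (u : SG3 → 𝕜) (b : Fin 3 → 𝕜), rawEnergy m u (decimated l m b) =
      l m / 2 * vertexSum m (fun x => u x * decimated l m b x) +
        (∏ k ∈ Finset.range m, fluxFactor (l (k + 1))) * ∑ a, u (q a) * cornerDeriv (l 0) b a := by
  induction m with
  | zero =>
    intro l _ _ u b
    have hq : decimated l 0 b ∘ q = b := funext (decimated_q l 0 b)
    rw [rawEnergy_zero, hq]
    simp only [vertexSum, decimated_q, Finset.range_zero, Finset.prod_empty, one_mul,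
      Finset.mul_sum, ← Finset.sum_add_distrib]
    refine Finset.sum_congr rfl fun a _ => ?_
    simp only [cornerDeriv]
    ring
  | succ m ih =>
    intro l hrel hne u b
    have key := sum_mul_cornerDeriv_extend (hne 0) (hrel 0) u b
    rw [rawEnergy_succ, Finset.prod_range_succ']
    simp only [decimated_succ_comp_F]
    simp only [ih (fun k => l (k + 1)) (fun k => hrel (k + 1)) (fun k => hne (k + 1)),
      Finset.sum_add_distrib, ← Finset.mul_sum, Function.comp_apply]
    simp only [zero_add] at key ⊢
    rw [key, ← mul_assoc, vertexSum]
    simp only [Function.comp_def, decimated_succ_F]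

/-! ### Uniform bounds and quadrature -/

/-- The deviation of the extension with parameter `x` from the harmonic extension. -/
def deviation (x : 𝕜) : ℝ :=
  ‖nearWeight x - nearWeight 0‖ + ‖farWeight x - farWeight 0‖ + ‖oppWeight x - oppWeight 0‖ +
    3 * ‖centerWeight x - centerWeight 0‖

theorem deviation_nonneg (x : 𝕜) : 0 ≤ deviation x := by
  unfold deviation
  positivity

theorem norm_sideValue_sub_le (x p s t : 𝕜) {R : ℝ} (hp : ‖p‖ ≤ R) (hs : ‖s‖ ≤ R) (ht : ‖t‖ ≤ R) :
    ‖sideValue x p s t - sideValue 0 p s t‖ ≤ deviation x * R := by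
  have h : sideValue x p s t - sideValue 0 p s t = (nearWeight x - nearWeight 0) * p +
      (farWeight x - farWeight 0) * s + (oppWeight x - oppWeight 0) * t := by
    unfold sideValue
    ring
  have hR : 0 ≤ R := (norm_nonneg p).trans hp
  rw [h]
  refine norm_add₃_le.trans ?_
  simp only [norm_mul, deviation]
  have h1 := mul_le_mul_of_nonneg_left hp (norm_nonneg (nearWeight x - nearWeight 0))
  have h2 := mul_le_mul_of_nonneg_left hs (norm_nonneg (farWeight x - farWeight 0))
  have h3 := mul_le_mul_of_nonneg_left ht (norm_nonneg (oppWeight x - oppWeight 0))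
  have h4 := mul_nonneg (norm_nonneg (centerWeight x - centerWeight 0)) hR
  linarith

theorem norm_nodeValue_sub_le (x : 𝕜) (b : Fin 3 → 𝕜) (n : Fin 10) :
    ‖nodeValue x b n - nodeValue 0 b n‖ ≤ deviation x * ‖b‖ := by
  have hb := norm_le_pi_norm b
  have hside := fun a c d : Fin 3 => norm_sideValue_sub_le x _ _ _ (hb a) (hb c) (hb d)
  have hpos := mul_nonneg (deviation_nonneg x) (norm_nonneg b)
  have hcorner : ∀ a, ‖b a - b a‖ ≤ deviation x * ‖b‖ := fun a => by
    rwa [sub_self, norm_zero]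
  have hcenter : ‖centerWeight x * (b 0 + b 1 + b 2) - centerWeight 0 * (b 0 + b 1 + b 2)‖ ≤
      deviation x * ‖b‖ := by
    rw [← sub_mul, norm_mul]
    have h3 : ‖b 0 + b 1 + b 2‖ ≤ 3 * ‖b‖ := by
      refine norm_add₃_le.trans ?_
      have := hb 0
      have := hb 1
      have := hb 2
      linarith
    have h1 := mul_le_mul_of_nonneg_left h3 (norm_nonneg (centerWeight x - centerWeight 0))
    have h2 : 3 * ‖centerWeight x - centerWeight 0‖ ≤ deviation x := by
      unfold deviation
      have := norm_nonneg (nearWeight x - nearWeight 0)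
      have := norm_nonneg (farWeight x - farWeight 0)
      have := norm_nonneg (oppWeight x - oppWeight 0)
      linarith
    have h4 := mul_le_mul_of_nonneg_right h2 (norm_nonneg b)
    linarith
  fin_cases n
  exacts [hcorner 0, hcorner 1, hcorner 2, hside 0 1 2, hside 0 2 1, hside 1 0 2, hside 1 2 0,
    hside 2 0 1, hside 2 1 0, hcenter]

theorem norm_extend_le (x : 𝕜) (b : Fin 3 → 𝕜) (j : Fin 6) :
    ‖extend x b j‖ ≤ (1 + deviation x) * ‖b‖ := by
  have hpos := deviation_nonneg x
  refine (pi_norm_le_iff_of_nonneg (by positivity)).2 fun a => ?_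
  have h1 := norm_nodeValue_sub_le x b (node j a)
  have h2 : ‖nodeValue 0 b (node j a)‖ ≤ ‖b‖ := by
    simpa using norm_nodeValue_zero_sub_le (b := b) (c := 0) (R := ‖b‖)
      (fun a => by simpa using norm_le_pi_norm b a) (node j a)
  have h3 := norm_add_le (nodeValue x b (node j a) - nodeValue 0 b (node j a))
    (nodeValue 0 b (node j a))
  rw [sub_add_cancel] at h3
  have : extend x b j a = nodeValue x b (node j a) := rfl
  rw [this]
  linarith

/-- A bound for the growth of the decimated splines. -/
def growth (l : ℕ → 𝕜) (m : ℕ) : ℝ := ∏ k ∈ Finset.range m, (1 + deviation (l (k + 1)))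

theorem growth_nonneg (l : ℕ → 𝕜) (m : ℕ) : 0 ≤ growth l m :=
  Finset.prod_nonneg fun _ _ => add_nonneg zero_le_one (deviation_nonneg _)

theorem growth_succ (l : ℕ → 𝕜) (m : ℕ) :
    growth l (m + 1) = growth (fun k => l (k + 1)) m * (1 + deviation (l 1)) :=
  Finset.prod_range_succ' _ _

theorem growth_mul_norm_extend_le (l : ℕ → 𝕜) (m : ℕ) (b : Fin 3 → 𝕜) (j : Fin 6) :
    growth (fun k => l (k + 1)) m * ‖extend (l 1) b j‖ ≤ growth l (m + 1) * ‖b‖ := by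
  rw [growth_succ, mul_assoc]
  exact mul_le_mul_of_nonneg_left (norm_extend_le _ _ _) (growth_nonneg _ _)

theorem norm_decimated_le (m : ℕ) : ∀ (l : ℕ → 𝕜) (b : Fin 3 → 𝕜) (x : SG3),
    ‖decimated l m b x‖ ≤ growth l m * ‖b‖ := by
  induction m with
  | zero =>
    intro l b x
    simpa [growth, decimated_zero] using norm_harmonic_le b x
  | succ m ih =>
    intro l b x
    obtain ⟨j, y, rfl⟩ := exists_F_eq x
    rw [decimated_succ_F]
    exact (ih _ _ y).trans (growth_mul_norm_extend_le l m b j)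

/-- With `u` frozen at `u (q 0)` the rule is exact by `integral_harmonic`; the sum and the integral
then contribute one error `δ * ‖b‖` each. -/
theorem norm_quadrature_harmonic_sub_le {u : SG3 → 𝕜} (hu : Continuous u) {δ : ℝ}
    (h : ∀ x y, ‖u x - u y‖ ≤ δ) (b : Fin 3 → 𝕜) :
    ‖1 / 3 * ∑ a, u (q a) * b a - ∫ x, u x * harmonic b x ∂mu‖ ≤ 2 * δ * ‖b‖ := by
  have hδ : 0 ≤ δ := (norm_nonneg _).trans (h (q 0) (q 0))
  have h1 : ‖∑ a, (u (q a) - u (q 0)) * b a‖ ≤ ∑ _a : Fin 3, δ * ‖b‖ := by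
    refine norm_sum_le_of_le _ fun a _ => ?_
    rw [norm_mul]
    exact mul_le_mul (h _ _) (norm_le_pi_norm b a) (norm_nonneg _) hδ
  have h2 : ‖∫ x, (u x - u (q 0)) * harmonic b x ∂mu‖ ≤ δ * ‖b‖ := by
    have : ∀ x, ‖(u x - u (q 0)) * harmonic b x‖ ≤ δ * ‖b‖ := fun x => by
      rw [norm_mul]
      exact mul_le_mul (h _ _) (norm_harmonic_le b x) (norm_nonneg _) hδ
    simpa using norm_integral_le_of_norm_le_const (μ := mu) (Eventually.of_forall this)
  have hc := continuous_harmonic b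
  have h3 : ∫ x, (u x - u (q 0)) * harmonic b x ∂mu =
      ∫ x, u x * harmonic b x ∂mu - u (q 0) * (1 / 3 * ∑ a, b a) := by
    rw [← integral_harmonic, ← integral_const_mul, ← integral_sub]
    · simp only [sub_mul]
    · exact integrable_of_continuous (hu.mul hc)
    · exact integrable_of_continuous (continuous_const.mul hc)
  have h4 : 1 / 3 * ∑ a, u (q a) * b a - ∫ x, u x * harmonic b x ∂mu =
      1 / 3 * ∑ a, (u (q a) - u (q 0)) * b a - ∫ x, (u x - u (q 0)) * harmonic b x ∂mu := by
    rw [h3]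
    simp only [sub_mul, Finset.sum_sub_distrib, ← Finset.mul_sum]
    ring
  rw [h4]
  refine (norm_sub_le _ _).trans ?_
  rw [norm_mul]
  have h5 : ‖(1 / 3 : 𝕜)‖ = 1 / 3 := by simp
  rw [h5]
  simp only [Finset.sum_const, Finset.card_univ, Fintype.card_fin, nsmul_eq_mul] at h1
  push_cast at h1
  linarith

/-- The error of the quadrature formula with nodes at the vertices of level `m`. -/
theorem norm_quadrature_sub_le {D : ℝ} (hD : ∀ x y : SG3, dist x y ≤ D) (m : ℕ) :
    ∀ {u : SG3 → 𝕜} {δ : ℝ}, Continuous u →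
      (∀ x y, dist x y ≤ D * (1 / 3) ^ m → ‖u x - u y‖ ≤ δ) →
      ∀ (l : ℕ → 𝕜) (b : Fin 3 → 𝕜),
        ‖1 / 3 * (1 / 6) ^ m * vertexSum m (fun x => u x * decimated l m b x) -
          ∫ x, u x * decimated l m b x ∂mu‖ ≤ 2 * δ * (growth l m * ‖b‖) := by
  induction m with
  | zero =>
    intro u δ hu h l b
    have := norm_quadrature_harmonic_sub_le hu (fun x y => h x y (by simpa using hD x y)) b
    simpa [vertexSum, decimated_zero, harmonic_q, growth] using this
  | succ m ih =>
    intro u δ hu h l b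
    have hδ : 0 ≤ δ := (norm_nonneg _).trans (h (q 0) (q 0) (by
      have := hD (q 0) (q 0)
      rw [dist_self] at this ⊢
      positivity))
    rw [integral_eq_sum_cells (f := fun x => u x * decimated l (m + 1) b x)
      (hu.mul (continuous_decimated l _ b)), vertexSum]
    simp only [Function.comp_def, decimated_succ_F]
    have h1 : ∀ j, ‖1 / 3 * (1 / 6) ^ m * vertexSum m (fun x => u (F j x) *
          decimated (fun k => l (k + 1)) m (extend (l 1) b j) x) -
          ∫ x, u (F j x) * decimated (fun k => l (k + 1)) m (extend (l 1) b j) x ∂mu‖ ≤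
        2 * δ * (growth l (m + 1) * ‖b‖) := by
      intro j
      -- Passing to a cell divides distances by 3, so the same `δ` serves `u ∘ F j` at level `m`.
      refine (ih (hu.comp (continuous_F j)) (δ := δ) (fun x y hxy => h _ _ ?_) _ _).trans ?_
      · rw [dist_F, pow_succ]
        linarith
      · exact mul_le_mul_of_nonneg_left (growth_mul_norm_extend_le l m b j) (by positivity)
    have h2 := norm_sum_le_of_le Finset.univ fun j _ => h1 j
    rw [Finset.sum_sub_distrib, ← Finset.mul_sum] at h2
    have h3 : ‖(1 / 6 : 𝕜)‖ = 1 / 6 := by simp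
    have h4 : ∀ A B : 𝕜, 1 / 3 * (1 / 6) ^ (m + 1) * A - 1 / 6 * B =
        1 / 6 * (1 / 3 * (1 / 6) ^ m * A - B) := fun A B => by ring
    rw [h4, norm_mul, h3]
    simp only [Finset.sum_const, Finset.card_univ, Fintype.card_fin, nsmul_eq_mul] at h2
    push_cast at h2
    linarith

end Decimation

section Limits

variable {𝕜 : Type*} [RCLike 𝕜] {l : ℕ → 𝕜} {lam : 𝕜}

/-! ### Consequences of the decay of a decimation sequence -/

theorem IsDecimationSequence.isBigO (hl : IsDecimationSequence l lam) :
    l =O[atTop] fun m : ℕ => ((7 : ℝ) / 90) ^ m := by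
  have h1 := hl.tendsto.isBigO_one ℝ
  have h2 : (fun m : ℕ => (2 / 3 : 𝕜) * (7 / 90) ^ m) =O[atTop]
      fun m : ℕ => ((7 : ℝ) / 90) ^ m := by
    refine Asymptotics.IsBigO.const_mul_left (Asymptotics.IsBigO.of_norm_left ?_) _
    simpa using Asymptotics.isBigO_refl _ _
  refine (h2.mul h1).congr (fun m => ?_) fun m => mul_one _
  have : (7 / 90 : 𝕜) ^ m * (90 / 7) ^ m = 1 := by
    rw [← mul_pow]
    norm_num
  linear_combination l m * this

theorem IsDecimationSequence.summable_norm (hl : IsDecimationSequence l lam) :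
    Summable fun m => ‖l (m + 1)‖ :=
  (summable_nat_add_iff 1).2 <| summable_of_isBigO_nat
    (summable_geometric_of_lt_one (by norm_num) (by norm_num)) hl.isBigO.norm_left

/-- The sequence decays geometrically and `f` is Lipschitz to first order at 0. This yields both the
convergence of the product and the bound on `growth`. -/
theorem IsDecimationSequence.summable_norm_sub (hl : IsDecimationSequence l lam) {f : 𝕜 → 𝕜}
    (hf : DifferentiableAt 𝕜 f 0) : Summable fun m => ‖f (l (m + 1)) - f 0‖ := by
  have h0 : Tendsto (fun m => l (m + 1)) atTop (𝓝 0) :=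
    tendsto_zero_iff_norm_tendsto_zero.2 hl.summable_norm.tendsto_atTop_zero
  have h := (hf.isBigO_sub.comp_tendsto h0).norm_left.norm_right
  refine summable_of_isBigO_nat hl.summable_norm ?_
  simpa [Function.comp_def] using h

theorem IsDecimationSequence.multipliable (hl : IsDecimationSequence l lam) :
    Multipliable fun j : ℕ => tauFactor (l (j + 1)) := by
  have hf : DifferentiableAt 𝕜 (tauFactor : 𝕜 → 𝕜) 0 := by
    unfold tauFactor
    refine DifferentiableAt.div (by fun_prop) (by fun_prop) (by norm_num)
  have h0 : tauFactor (0 : 𝕜) = 1 := by norm_num [tauFactor]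
  have h := multipliable_one_add_of_summable (hl.summable_norm_sub hf)
  simpa [h0] using h

theorem IsDecimationSequence.summable_deviation (hl : IsDecimationSequence l lam) :
    Summable fun m => deviation (l (m + 1)) := by
  have h1 : DifferentiableAt 𝕜 (nearWeight : 𝕜 → 𝕜) 0 := by
    unfold nearWeight
    exact DifferentiableAt.div (by fun_prop) (by fun_prop) (by norm_num)
  have h2 : DifferentiableAt 𝕜 (farWeight : 𝕜 → 𝕜) 0 := by
    unfold farWeight
    exact DifferentiableAt.div (by fun_prop) (by fun_prop) (by norm_num)
  have h3 : DifferentiableAt 𝕜 (oppWeight : 𝕜 → 𝕜) 0 := by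
    unfold oppWeight
    exact DifferentiableAt.div (by fun_prop) (by fun_prop) (by norm_num)
  have h4 : DifferentiableAt 𝕜 (centerWeight : 𝕜 → 𝕜) 0 := by
    unfold centerWeight
    exact DifferentiableAt.div (by fun_prop) (by fun_prop) (by norm_num)
  exact (((hl.summable_norm_sub h1).add (hl.summable_norm_sub h2)).add
    (hl.summable_norm_sub h3)).add ((hl.summable_norm_sub h4).mul_left 3)

theorem IsDecimationSequence.exists_growth_le (hl : IsDecimationSequence l lam) :
    ∃ K, ∀ m, growth l m ≤ K := by
  refine ⟨Real.exp (∑' k, deviation (l (k + 1))), fun m => ?_⟩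
  calc growth l m ≤ ∏ k ∈ Finset.range m, Real.exp (deviation (l (k + 1))) := by
        refine Finset.prod_le_prod (fun _ _ => add_nonneg zero_le_one (deviation_nonneg _))
          fun k _ => ?_
        rw [add_comm]
        exact Real.add_one_le_exp _
    _ = Real.exp (∑ k ∈ Finset.range m, deviation (l (k + 1))) := (Real.exp_sum _ _).symm
    _ ≤ _ := Real.exp_le_exp.2
        (hl.summable_deviation.sum_le_tsum _ fun _ _ => deviation_nonneg _)

/-- Telescoping of `fluxFactor (l (k+1)) * l k = 6 * l (k+1) * tauFactor (l (k+1))`, with `6 * r⁻¹ =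
90 / 7`. -/
theorem IsDecimationSequence.prod_fluxFactor_mul (hl : IsDecimationSequence l lam) (m : ℕ) :
    ((r⁻¹ ^ m : ℝ) : 𝕜) * (∏ k ∈ Finset.range m, fluxFactor (l (k + 1))) * l 0 =
      (90 / 7) ^ m * l m * ∏ k ∈ Finset.range m, tauFactor (l (k + 1)) := by
  have hr : ((r⁻¹ : ℝ) : 𝕜) = 15 / 7 := by
    unfold r
    push_cast
    norm_num
  induction m with
  | zero => simp
  | succ m ih =>
    have hx := hl.not_forbidden m
    have h := fluxFactor_mul hx (hl.relation m)
    have ht : l (m + 1) * (4 - l (m + 1)) * (6 - l (m + 1)) /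
        (4 - 6 * l (m + 1) + l (m + 1) ^ 2) = 6 * l (m + 1) * tauFactor (l (m + 1)) := by
      have hq : 4 - 6 * l (m + 1) + l (m + 1) ^ 2 ≠ 0 := right_ne_zero_of_mul hx
      have hd : 1 - 3 / 2 * l (m + 1) + l (m + 1) ^ 2 / 4 =
          (4 - 6 * l (m + 1) + l (m + 1) ^ 2) / 4 := by ring
      rw [tauFactor, hd]
      generalize 4 - 6 * l (m + 1) + l (m + 1) ^ 2 = Q at hq ⊢
      field_simp
    rw [ht] at h
    rw [Finset.prod_range_succ, Finset.prod_range_succ]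
    push_cast at ih hr ⊢
    rw [pow_succ, pow_succ]
    rw [hr] at ih ⊢
    linear_combination 15 / 7 * fluxFactor (l (m + 1)) * ih + 15 / 7 * (90 / 7) ^ m *
      (∏ k ∈ Finset.range m, tauFactor (l (k + 1))) * h

theorem IsDecimationSequence.tendsto_prod_fluxFactor (hl : IsDecimationSequence l lam)
    (hl0 : l 0 ≠ 0) :
    Tendsto (fun m => ((r⁻¹ ^ m : ℝ) : 𝕜) * ∏ k ∈ Finset.range m, fluxFactor (l (k + 1))) atTop
      (𝓝 (tau l lam)) := by
  have h := ((hl.tendsto.mul hl.multipliable.hasProd.tendsto_prod_nat).const_mul (2 / 3)).div_const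
    (l 0)
  have he : 2 / 3 * (lam * ∏' j : ℕ, tauFactor (l (j + 1))) / l 0 = tau l lam := by
    unfold tau
    field_simp
  rw [he] at h
  refine h.congr fun m => ?_
  rw [div_eq_iff hl0, hl.prod_fluxFactor_mul]
  ring

/-! ### Passage to the limit -/

theorem tendsto_quadrature_sub (hl : IsDecimationSequence l lam) {u : SG3 → 𝕜} (hu : Continuous u)
    (b : Fin 3 → 𝕜) :
    Tendsto (fun m => 1 / 3 * (1 / 6) ^ m * vertexSum m (fun x => u x * decimated l m b x) -
      ∫ x, u x * decimated l m b x ∂mu) atTop (𝓝 0) := by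
  obtain ⟨K, hK⟩ := hl.exists_growth_le
  have hK0 : 0 ≤ K := (growth_nonneg l 0).trans (hK 0)
  obtain ⟨D, hD⟩ : ∃ D, ∀ x y : SG3, dist x y ≤ D :=
    ⟨Metric.diam (Set.univ : Set SG3), fun x y =>
      Metric.dist_le_diam_of_mem isCompact_univ.isBounded (Set.mem_univ x) (Set.mem_univ y)⟩
  have hlim : Tendsto (fun m : ℕ => D * (1 / 3 : ℝ) ^ m) atTop (𝓝 0) := by
    simpa using (tendsto_pow_atTop_nhds_zero_of_lt_one
      (by norm_num : (0 : ℝ) ≤ 1 / 3) (by norm_num)).const_mul D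
  refine Metric.tendsto_atTop'.2 fun ε hε => ?_
  -- The summand 1 keeps the denominator positive when `K * ‖b‖ = 0` and makes the final inequality
  -- strict.
  set δ := ε / (2 * (K * ‖b‖) + 1) with hδ
  have hpos : 0 < 2 * (K * ‖b‖) + 1 := by positivity
  have hδ0 : 0 < δ := div_pos hε hpos
  obtain ⟨η, hη, hu'⟩ := Metric.uniformContinuous_iff.1
    (CompactSpace.uniformContinuous_of_continuous hu) δ hδ0
  obtain ⟨N, hN⟩ := eventually_atTop.1 (hlim.eventually (gt_mem_nhds hη))
  refine ⟨N, fun m hm => ?_⟩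
  rw [dist_zero_right]
  have h1 := norm_quadrature_sub_le hD m hu (δ := δ) (fun x y hxy => by
    rw [← dist_eq_norm]
    exact (hu' (hxy.trans_lt (hN m hm.le))).le) l b
  have h2 : growth l m * ‖b‖ ≤ K * ‖b‖ := mul_le_mul_of_nonneg_right (hK m) (norm_nonneg b)
  calc _ ≤ 2 * δ * (growth l m * ‖b‖) := h1
    _ ≤ 2 * δ * (K * ‖b‖) := mul_le_mul_of_nonneg_left h2 (by positivity)
    _ < δ * (2 * (K * ‖b‖) + 1) := by linarith
    _ = ε := div_mul_cancel₀ _ hpos.ne'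

/-- Only the difference converges visibly: the quadrature error is multiplied by a convergent
sequence, and the error in `lam` by bounded integrals. -/
theorem tendsto_vertexSum_sub_integral (hl : IsDecimationSequence l lam) {u : SG3 → 𝕜}
    (hu : Continuous u) (b : Fin 3 → 𝕜) :
    Tendsto (fun m => 3 / 2 * ((90 / 7) ^ m * l m) *
      (1 / 3 * (1 / 6) ^ m * vertexSum m (fun x => u x * decimated l m b x)) -
      lam * ∫ x, u x * decimated l m b x ∂mu) atTop (𝓝 0) := by
  obtain ⟨K, hK⟩ := hl.exists_growth_le
  obtain ⟨C, hC⟩ : ∃ C, ∀ x, ‖u x‖ ≤ C := by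
    obtain ⟨C, hC⟩ := isCompact_univ.exists_bound_of_continuousOn hu.continuousOn
    exact ⟨C, fun x => hC x (Set.mem_univ x)⟩
  have hC0 : 0 ≤ C := (norm_nonneg _).trans (hC (q 0))
  have hint : ∀ m, ‖∫ x, u x * decimated l m b x ∂mu‖ ≤ C * (K * ‖b‖) := by
    intro m
    have h : ∀ x, ‖u x * decimated l m b x‖ ≤ C * (K * ‖b‖) := fun x => by
      rw [norm_mul]
      refine mul_le_mul (hC x) ((norm_decimated_le m l b x).trans ?_) (norm_nonneg _) hC0
      exact mul_le_mul_of_nonneg_right (hK m) (norm_nonneg b)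
    simpa using norm_integral_le_of_norm_le_const (μ := mu) (Eventually.of_forall h)
  have h1 := hl.tendsto.mul (tendsto_quadrature_sub hl hu b)
  have h2 : Tendsto (fun m => (3 / 2 * ((90 / 7) ^ m * l m) - lam) *
      ∫ x, u x * decimated l m b x ∂mu) atTop (𝓝 0) := by
    refine squeeze_zero_norm (a := fun m => ‖3 / 2 * ((90 / 7) ^ m * l m) - lam‖ *
      (C * (K * ‖b‖))) (fun m => ?_) ?_
    · rw [norm_mul]
      exact mul_le_mul_of_nonneg_left (hint m) (norm_nonneg _)
    · simpa using ((hl.tendsto.sub_const lam).norm).mul_const (C * (K * ‖b‖))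
  have h3 := h1.add h2
  rw [mul_zero, add_zero] at h3
  refine h3.congr fun m => ?_
  ring

theorem tendsto_integral_mul_spike {u : SG3 → 𝕜} (hu : Continuous u) (i : Fin 3) :
    Tendsto (fun m => ∫ x, u x * spike i m x ∂mu) atTop (𝓝 0) := by
  obtain ⟨C, hC⟩ := isCompact_univ.exists_bound_of_continuousOn hu.continuousOn
  refine squeeze_zero_norm (fun m =>
    norm_integral_mul_spike_le i m hu fun x => hC x (Set.mem_univ x)) ?_
  simpa using (tendsto_pow_atTop_nhds_zero_of_lt_one
    (by norm_num : (0 : ℝ) ≤ 1 / 6) (by norm_num)).const_mul C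

/-- The normal derivatives of an eigenfunction in terms of its boundary values. -/
theorem hasNormalDeriv_of_hasLaplacian (hl : IsDecimationSequence l lam) (hl0 : l 0 ≠ 0)
    {u : SG3 → 𝕜} (hu : HasLaplacian u fun x => -(lam * u x)) (i : Fin 3) :
    HasNormalDeriv u i
      (tau l lam * ∑ a, u (q a) * cornerDeriv (l 0) (Pi.single i 1) a) := by
  set b : Fin 3 → 𝕜 := Pi.single i 1 with hb
  have hc := hu.1.1
  have hformula : ∀ m, ((r⁻¹ ^ m : ℝ) : 𝕜) * flux m u i =
      ((r⁻¹ ^ m : ℝ) : 𝕜) * (∏ k ∈ Finset.range m, fluxFactor (l (k + 1))) *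
        (∑ a, u (q a) * cornerDeriv (l 0) b a) +
      (3 / 2 * ((90 / 7) ^ m * l m) *
        (1 / 3 * (1 / 6) ^ m * vertexSum m (fun x => u x * decimated l m b x)) -
        lam * ∫ x, u x * decimated l m b x ∂mu) + lam * ∫ x, u x * spike i m x ∂mu := by
    intro m
    have hT := continuous_decimated l m b
    have hS := continuous_spike (𝕜 := 𝕜) i m
    -- The decimated spline and the spike have the same corner values, so their difference is an
    -- admissible test function.
    have h := hu.graphEnergy_spline ((isSpline_decimated m l b).sub (isSpline_spike i m))
      (hT.sub hS) fun a => by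
        rw [decimated_q, (spike_q_and_compatible i m).1, hb, sub_self]
    have hi : -∫ x, -(lam * u x) * (decimated l m b x - spike i m x) ∂mu =
        lam * (∫ x, u x * decimated l m b x ∂mu - ∫ x, u x * spike i m x ∂mu) := by
      have hTi : Integrable (fun x => u x * decimated l m b x) mu :=
        integrable_of_continuous (hc.mul hT)
      have hSi : Integrable (fun x => u x * spike i m x) mu :=
        integrable_of_continuous (hc.mul hS)
      rw [← integral_sub hTi hSi, ← integral_const_mul, ← integral_neg]
      congr 1
      funext x
      ring
    rw [hi, graphEnergy_eq, rawEnergy_sub_right, rawEnergy_spike,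
      rawEnergy_decimated m l hl.relation hl.not_forbidden] at h
    -- Energy scaling splits into eigenvalue scaling and measure scaling, `15 / 7 = (90 / 7) * (1 /
    -- 6)`, while `l m / 2` is `3 / 2 * l m` times the quadrature weight `1 / 3`.
    have hr : ((r⁻¹ ^ m : ℝ) : 𝕜) = (90 / 7) ^ m * (1 / 6) ^ m := by
      rw [← mul_pow]
      unfold r
      push_cast
      norm_num
    rw [hr] at h ⊢
    linear_combination -h
  have hlim := (((hl.tendsto_prod_fluxFactor hl0).mul_const
    (∑ a, u (q a) * cornerDeriv (l 0) b a)).add (tendsto_vertexSum_sub_integral hl hc b)).add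
      ((tendsto_integral_mul_spike hc i).const_mul lam)
  rw [mul_zero, add_zero, add_zero] at hlim
  exact hlim.congr fun m => (hformula m).symm

end Limits

end SGThree
end

theorem mainTheorem6 {𝕜 : Type*} [RCLike 𝕜] (lam : 𝕜) (l : ℕ → 𝕜)
    (hl : SGThree.IsDecimationSequence l lam) (hl0 : l 0 ≠ 0)
    (u : SG3 → 𝕜) (hu : SGThree.HasLaplacian u (fun x => -(lam * u x)))
    (hu0 : u (SGThree.q 0) = 1) (hu1 : u (SGThree.q 1) = 0) (hu2 : u (SGThree.q 2) = 0) :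
    Multipliable (fun j : ℕ => SGThree.tauFactor (l (j + 1))) ∧
      SGThree.HasNormalDeriv u 0 ((4 - l 0) / 2 * SGThree.tau l lam) ∧
      SGThree.HasNormalDeriv u 1 (-SGThree.tau l lam) ∧
      SGThree.HasNormalDeriv u 2 (-SGThree.tau l lam) := by
  have h := SGThree.hasNormalDeriv_of_hasLaplacian hl hl0 hu
  simp only [Fin.sum_univ_three, hu0, hu1, hu2, SGThree.cornerDeriv, zero_mul, add_zero,
    one_mul] at h
  refine ⟨hl.multipliable, ?_, ?_, ?_⟩
  · convert h 0 using 1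
    simp
    ring
  · convert h 1 using 1
    simp
  · convert h 2 using 1
    simp
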